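/- **Setting.** Let $(X_i,Y_i)$, $i\ge 1$, be i.i.d., where $Y_i\in\mathbb R^q$ is a square-integrable response and $X_i\in\mathbb R^{q\times p}$ has rows $X_{ij}^T$. They follow the marginal model $h(\mu_{ij})=X_{ij}^T\beta$, $\nu_{ij}=\psi\,v(\mu_{ij})>0$, where $\mu_{ij}=E(Y_{ij}\mid X_{ij})$ and $\nu_{ij}=\mathrm{Var}(Y_{ij}\mid X_{ij})$ at the true value $\beta=\beta_0$, with known link $h$ (with differentiable inverse) and known variance function $v$. Write $\mu_i(\beta)=(\mu_{ij}(\beta))_j$, $\dot\mu_i=\partial\mu_i/\partial\beta^T$ and $A_i(\beta)=\mathrm{diag}(\psi v(\mu_{ij}(\beta)))_j$. Let $M_1,\dots,M_L$ be given $q\times q$ matrices, let $\Omega_1,\dots,\Omega_K$ be a partition of the range of $X$ into sets of positive probability, and let $\phi_k=E(Y\mid X\in\Omega_k)$ be known. Let $g(\beta,X_i)\in\mathbb R^{pL+Kq}$ be obtained by stacking $S(\beta,X_i)$, with blocks $\dot\mu_i^TA_i^{-1/2}M_lA_i^{-1/2}(Y_i-\mu_i)$, $l\le L$, and $\Psi(\beta,X_i)$,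 with blocks $1(X_i\in\Omega_k)(\mu_i(\beta)-\phi_k)$, $k\le K$. Put $$g_n(\beta)=\frac1n\sum_{i=1}^n g(\beta,X_i),\quad \Sigma_n(\beta)=\frac1n\sum_{i=1}^n g(\beta,X_i)g(\beta,X_i)^T,\quad G_n(\beta)=\frac{\partial g_n(\beta)}{\partial\beta^T},\quad Q_n(\beta)=g_n(\beta)^T\Sigma_n(\beta)^{-1}g_n(\beta),$$ where $Q_n(\beta)$ is defined whenever $\Sigma_n(\beta)$ is invertible. **Conditions.** - C1. The parameter space $\Theta\subset\mathbb R^p$ is compact, $g(\beta,X)$ is integrable for every $\beta\in\Theta$, and $\beta_0$, an interior point of $\Theta$, is the only $\beta\in\Theta$ with $E\,g(\beta,X)=0$. - C2. $E\{S(\beta_0,X)S(\beta_0,X)^T\}$ and $E\{\Psi(\beta_0,X)\Psi(\beta_0,X)^T\}$ are finite and positive definite. - C3. $A(\beta)$ is twice continuously differentiable in $\beta$ and, with its partial derivatives up to order two, bounded uniformly in $\beta$ and in the covariates. - C4. $\Sigma_n(\beta)$ is twice continuously differentiable on $\Theta$, and there is a matrix function $\Sigma(\beta)$, continuous and positive definite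 at $\beta_0$, with $\sup_{\beta\in\Theta}\|\Sigma_n(\beta)-\Sigma(\beta)\|=o_p(1)$. - C5. $g_n(\beta)$ is twice continuously differentiable on $\Theta$, and there is a function $g(\beta)$, continuous at $\beta_0$, with $\sup_{\beta\in\Theta}\|g_n(\beta)-g(\beta)\|=o_p(1)$; moreover there are a neighbourhood $V$ of $\beta_0$ and a matrix function $G(\beta)$, continuous at $\beta_0$, with $\sup_{\beta\in V}\|G_n(\beta)-G(\beta)\|=o_p(1)$, and $B=G(\beta_0)$ has full column rank $p$. **Theorem.** Write $\beta=(\gamma^T,\lambda^T)^T$ with $\gamma\in\mathbb R^{p_1}$, $\lambda\in\mathbb R^{p-p_1}$, and suppose that $H_0:\gamma=\gamma_0$ holds, that is, $\beta_0=(\gamma_0,\lambda_0)$. Let $(\hat\gamma,\hat\lambda)$ be the GMM estimator, a measurable minimizer of $Q_n$ over $\Theta$, and let $\tilde\lambda$ be the constrained GMM estimator, a measurable minimizer of $\lambda\mapsto Q_n(\gamma_0,\lambda)$ over $\{\lambda:(\gamma_0,\lambda)\in\Theta\}$ (in both cases among the points at which $Q_n$ is defined, and whenever a minimizer exists). Then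 under C1–C5, as $n\to\infty$, $$n\{Q_n(\gamma_0,\tilde\lambda)-Q_n(\hat\gamma,\hat\lambda)\}\ \xrightarrow{\ \mathcal D\ }\ \chi^2_{p_1}.$$ -/

import Mathlib

open MeasureTheory ProbabilityTheory Filter Topology

/-- The parameter `β = (γ, λ)`, with `γ ∈ ℝ^p₁` and `λ ∈ ℝ^p₂`; its dimension is `p = p₁ + p₂`. -/
abbrev Param (p₁ p₂ : ℕ) : Type := Fin p₁ ⊕ Fin p₂ → ℝ

/-- A `q × p` covariate matrix; row `j` is the covariate vector of the `j`-th measurement. -/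
abbrev Covariate (p₁ p₂ q : ℕ) : Type := Fin q → Fin p₁ ⊕ Fin p₂ → ℝ

/-- The observation of one subject: covariate matrix and response vector. -/
abbrev Obs (p₁ p₂ q : ℕ) : Type := Covariate p₁ p₂ q × (Fin q → ℝ)

/-- Index set of the `pL + Kq` moment functions: `L` blocks of size `p`, then `K` blocks of
size `q`. -/
abbrev MomentIdx (p₁ p₂ q L K : ℕ) : Type :=
  (Fin L × (Fin p₁ ⊕ Fin p₂)) ⊕ (Fin K × Fin q)

/-- The chi-squared distribution with `k` degrees of freedom: the law of the sum of the squares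
of `k` independent standard normal variables. -/
noncomputable def chiSquared (k : ℕ) : Measure ℝ :=
  (Measure.pi fun _ : Fin k => gaussianReal 0 1).map fun z => ∑ i, z i ^ 2

instance (k : ℕ) : IsProbabilityMeasure (chiSquared k) :=
  Measure.isProbabilityMeasure_map (Measurable.aemeasurable (by fun_prop))

/-- Everything the statistician knows apart from the sample: the link `h`, its inverse (the mean
as a function of the linear predictor), the variance function `v`, the scale `ψ`, the basis
matrices `M_l`, the subgroups `Ω_k` and the subgroup means `φ_k`. -/
structure MarginalSpec (p₁ p₂ q L K : ℕ) where
  link : ℝ → ℝ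
  mean : ℝ → ℝ
  varFun : ℝ → ℝ
  scale : ℝ
  basis : Fin L → Matrix (Fin q) (Fin q) ℝ
  group : Fin K → Set (Covariate p₁ p₂ q)
  phi : Fin K → Fin q → ℝ

namespace MarginalSpec

variable {p₁ p₂ q L K : ℕ} (s : MarginalSpec p₁ p₂ q L K)

/-- The mean vector `μ(β)` for the covariate matrix `x`: `h(μ_j) = x_jᵀ β`. -/
noncomputable def mu (β : Param p₁ p₂) (x : Covariate p₁ p₂ q) : Fin q → ℝ :=
  fun j => s.mean (x j ⬝ᵥ β)

/-- The `q × p` matrix `∂μ / ∂βᵀ` (written out by the chain rule). -/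
noncomputable def muDot (β : Param p₁ p₂) (x : Covariate p₁ p₂ q) :
    Matrix (Fin q) (Fin p₁ ⊕ Fin p₂) ℝ :=
  Matrix.of fun j k => deriv s.mean (x j ⬝ᵥ β) * x j k

/-- The diagonal entries `ψ v(μ_j)` of the matrix `A(β)` of marginal conditional variances. -/
noncomputable def varA (β : Param p₁ p₂) (x : Covariate p₁ p₂ q) : Fin q → ℝ :=
  fun j => s.scale * s.varFun (s.mu β x j)

/-- The matrix `A^{-1/2}`. -/
noncomputable def invSqrtA (β : Param p₁ p₂) (x : Covariate p₁ p₂ q) :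
    Matrix (Fin q) (Fin q) ℝ :=
  Matrix.diagonal fun j => s.varA β x j ^ (-(1 / 2) : ℝ)

/-- The quadratic inference function scores `S(β, X)`: block `l` is
`μ̇ᵀ A^{-1/2} M_l A^{-1/2} (Y - μ)`. -/
noncomputable def score (β : Param p₁ p₂) (w : Obs p₁ p₂ q) :
    Fin L × (Fin p₁ ⊕ Fin p₂) → ℝ :=
  fun a => (((s.muDot β w.1).transpose * s.invSqrtA β w.1 * s.basis a.1 * s.invSqrtA β w.1).mulVec
    (w.2 - s.mu β w.1)) a.2

/-- The auxiliary moment functions `Ψ(β, X)`: block `k` is `1(X ∈ Ω_k) (μ(β) - φ_k)`. -/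
noncomputable def aux (β : Param p₁ p₂) (w : Obs p₁ p₂ q) : Fin K × Fin q → ℝ :=
  fun a => (s.group a.1).indicator (fun x => s.mu β x a.2 - s.phi a.1 a.2) w.1

/-- The stacked moment function `g(β, X) = (S(β, X), Ψ(β, X))`. -/
noncomputable def g (β : Param p₁ p₂) (w : Obs p₁ p₂ q) : MomentIdx p₁ p₂ q L K → ℝ :=
  Sum.elim (s.score β w) (s.aux β w)

/-- The sample moments `g_n(β)`, from the first `n` observations. -/
noncomputable def gBar (n : ℕ) (w : ℕ → Obs p₁ p₂ q) (β : Param p₁ p₂) :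
    MomentIdx p₁ p₂ q L K → ℝ :=
  fun a => (n : ℝ)⁻¹ * ∑ i ∈ Finset.range n, s.g β (w i) a

/-- The matrix `Σ_n(β) = n⁻¹ ∑ g gᵀ`. -/
noncomputable def sigmaBar (n : ℕ) (w : ℕ → Obs p₁ p₂ q) (β : Param p₁ p₂) :
    Matrix (MomentIdx p₁ p₂ q L K) (MomentIdx p₁ p₂ q L K) ℝ :=
  Matrix.of fun a b => (n : ℝ)⁻¹ * ∑ i ∈ Finset.range n, s.g β (w i) a * s.g β (w i) b

/-- The Jacobian `G_n(β) = ∂ g_n(β) / ∂βᵀ`. -/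
noncomputable def jacBar (n : ℕ) (w : ℕ → Obs p₁ p₂ q) (β : Param p₁ p₂) :
    Matrix (MomentIdx p₁ p₂ q L K) (Fin p₁ ⊕ Fin p₂) ℝ :=
  Matrix.of fun a k => fderiv ℝ (fun b => s.gBar n w b a) β (Pi.single k 1)

/-- The GMM objective `Q_n(β) = g_n(β)ᵀ Σ_n(β)⁻¹ g_n(β)`; meaningful where `Σ_n(β)` is
invertible. -/
noncomputable def Q (n : ℕ) (w : ℕ → Obs p₁ p₂ q) (β : Param p₁ p₂) : ℝ :=
  s.gBar n w β ⬝ᵥ (s.sigmaBar n w β)⁻¹.mulVec (s.gBar n w β)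

/-- `b` minimizes `Q_n` over the points of `C` at which `Q_n` is defined, that is, at which
`Σ_n` is invertible. -/
def IsGMM (C : Set (Param p₁ p₂)) (n : ℕ) (w : ℕ → Obs p₁ p₂ q) (b : Param p₁ p₂) : Prop :=
  (b ∈ C ∧ IsUnit (s.sigmaBar n w b).det) ∧
    ∀ β ∈ C, IsUnit (s.sigmaBar n w β).det → s.Q n w b ≤ s.Q n w β

end MarginalSpec

/-- The `L₂` norm of a vector. -/
noncomputable def vecNorm {ι : Type*} [Fintype ι] (u : ι → ℝ) : ℝ := √(∑ i, u i ^ 2)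

/-- The `L₂` (Frobenius) norm of a matrix. -/
noncomputable def matNorm {ι κ : Type*} [Fintype ι] [Fintype κ] (M : Matrix ι κ ℝ) : ℝ :=
  √(∑ i, ∑ k, M i k ^ 2)

/-- `sup_{β ∈ V} F_n(β) = o_p(1)`, for nonnegative random functions `F_n`. -/
def UnifLittleOP {Ω B : Type*} [MeasurableSpace Ω] (P : Measure Ω) (V : Set B)
    (F : ℕ → Ω → B → ℝ) : Prop :=
  ∀ δ > 0, Tendsto (fun n => P {ω | ∃ β ∈ V, δ ≤ F n ω β}) atTop (𝓝 0)

section Conditions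

variable {p₁ p₂ q L K : ℕ} {Ω : Type*} [MeasurableSpace Ω] (P : Measure Ω)
  (s : MarginalSpec p₁ p₂ q L K) (D : ℕ → Ω → Obs p₁ p₂ q)
  (Θ : Set (Param p₁ p₂)) (β₀ : Param p₁ p₂)

/-- The setting: independent, identically distributed subjects that follow the marginal model with
true parameter `β₀`, and correct auxiliary information on the subgroup means. -/
structure IsMarginalModel : Prop where
  measurable_mean : Measurable s.mean
  measurable_varFun : Measurable s.varFun
  measurable_data : ∀ i, Measurable (D i)
  indep : iIndepFun D P
  identDistrib : ∀ i, IdentDistrib (D i) (D 0) P P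
  /-- `mean` inverts the link, and is differentiable, at all possible linear predictors. -/
  link_mean : ∀ i, ∀ᵐ ω ∂P, ∀ β ∈ Θ, ∀ j,
    s.link (s.mean ((D i ω).1 j ⬝ᵥ β)) = (D i ω).1 j ⬝ᵥ β ∧
      DifferentiableAt ℝ s.mean ((D i ω).1 j ⬝ᵥ β)
  /-- The marginal variances are positive, so that `A^{-1/2}` makes sense. -/
  varA_pos : ∀ i, ∀ᵐ ω ∂P, ∀ β ∈ Θ, ∀ j, 0 < s.varA β (D i ω).1 j
  memLp_response : ∀ i j, MemLp (fun ω => (D i ω).2 j) 2 P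
  /-- `E(Y_ij | X_ij) = μ_ij`. -/
  cond_mean : ∀ i j,
    P[fun ω => (D i ω).2 j | MeasurableSpace.comap (fun ω => (D i ω).1 j) inferInstance]
      =ᵐ[P] fun ω => s.mu β₀ (D i ω).1 j
  /-- `Var(Y_ij | X_ij) = ψ v(μ_ij)`. -/
  cond_var : ∀ i j,
    Var[fun ω => (D i ω).2 j; P | MeasurableSpace.comap (fun ω => (D i ω).1 j) inferInstance]
      =ᵐ[P] fun ω => s.varA β₀ (D i ω).1 j
  /-- The subgroups form a partition of the range of the covariates. -/
  measurableSet_group : ∀ k, MeasurableSet (s.group k)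
  disjoint_group : Pairwise fun k k' => Disjoint (s.group k) (s.group k')
  cover_group : ∀ i, ∀ᵐ ω ∂P, ∃ k, (D i ω).1 ∈ s.group k
  /-- `E(Y | X ∈ Ω_k) = φ_k`. -/
  group_pos : ∀ k, P {ω | (D 0 ω).1 ∈ s.group k} ≠ 0
  group_mean : ∀ k j,
    ∫ ω, (D 0 ω).2 j ∂(cond P {ω | (D 0 ω).1 ∈ s.group k}) = s.phi k j

/-- The parameter space `Θ` is compact, `β₀` is an interior point of it, and is the unique zero in
`Θ` of `β ↦ E g(β, X)`. -/
structure UniqueZero : Prop where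
  isCompact : IsCompact Θ
  mem_interior : β₀ ∈ interior Θ
  integrable : ∀ β ∈ Θ, ∀ a, Integrable (fun ω => s.g β (D 0 ω) a) P
  zero_iff : ∀ β ∈ Θ, (∀ a, ∫ ω, s.g β (D 0 ω) a ∂P = 0) ↔ β = β₀

/-- `E(S Sᵀ)` and `E(Ψ Ψᵀ)`, at `β₀`, are finite and positive definite. -/
structure SecondMoments : Prop where
  integrable_score : ∀ a b, Integrable (fun ω => s.score β₀ (D 0 ω) a * s.score β₀ (D 0 ω) b) P
  posDef_score :
    (Matrix.of fun a b => ∫ ω, s.score β₀ (D 0 ω) a * s.score β₀ (D 0 ω) b ∂P).PosDef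
  integrable_aux : ∀ a b, Integrable (fun ω => s.aux β₀ (D 0 ω) a * s.aux β₀ (D 0 ω) b) P
  posDef_aux :
    (Matrix.of fun a b => ∫ ω, s.aux β₀ (D 0 ω) a * s.aux β₀ (D 0 ω) b ∂P).PosDef

/-- `A(β)` is twice continuously differentiable and, with its derivatives up to order two,
bounded uniformly in the parameter and in the covariates. -/
structure VarianceRegular : Prop where
  contDiffOn : ∀ᵐ ω ∂P, ∀ j, ContDiffOn ℝ 2 (fun β => s.varA β (D 0 ω).1 j) Θ
  bounded : ∃ C : ℝ, ∀ᵐ ω ∂P, ∀ j, ∀ k ≤ 2, ∀ β ∈ interior Θ,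
    ‖iteratedFDeriv ℝ k (fun β => s.varA β (D 0 ω).1 j) β‖ ≤ C

/-- `Σ_n(β)` is twice continuously differentiable and converges in probability, uniformly on the
parameter space, to some `Σ(β)` that is continuous and positive definite at `β₀`. -/
structure WeightRegular : Prop where
  contDiffOn : ∀ n, ∀ᵐ ω ∂P, ∀ a b,
    ContDiffOn ℝ 2 (fun β => s.sigmaBar n (fun i => D i ω) β a b) Θ
  limit : ∃ S : Param p₁ p₂ → Matrix (MomentIdx p₁ p₂ q L K) (MomentIdx p₁ p₂ q L K) ℝ,
    ContinuousAt S β₀ ∧ (S β₀).PosDef ∧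
    UnifLittleOP P Θ fun n ω β => matNorm (s.sigmaBar n (fun i => D i ω) β - S β)

/-- `g_n(β)` is twice continuously differentiable and converges in probability, uniformly on the
parameter space, to some `g(β)` that is continuous at `β₀`; its Jacobian `G_n(β)` converges in
probability, uniformly on some neighbourhood of `β₀`, to some `G(β)` that is continuous at `β₀`,
where it has full column rank. -/
structure MomentRegular : Prop where
  contDiffOn : ∀ n, ∀ᵐ ω ∂P, ContDiffOn ℝ 2 (s.gBar n (fun i => D i ω)) Θ
  limit : ∃ γ : Param p₁ p₂ → MomentIdx p₁ p₂ q L K → ℝ,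
    ContinuousAt γ β₀ ∧
    UnifLittleOP P Θ fun n ω β => vecNorm (s.gBar n (fun i => D i ω) β - γ β)
  jacobian : ∃ G : Param p₁ p₂ → Matrix (MomentIdx p₁ p₂ q L K) (Fin p₁ ⊕ Fin p₂) ℝ,
    ContinuousAt G β₀ ∧ Function.Injective (G β₀).mulVec ∧
    ∃ V ∈ 𝓝 β₀,
      UnifLittleOP P V fun n ω β => matNorm (s.jacBar n (fun i => D i ω) β - G β)

end Conditions

/-!
Write `g_n`, `Σ_n` for the sample moments and weights, `W = √n g_n(β₀)`, `B = G(β₀)`, `Σ₀ = Σ(β₀)`.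
On the scale `β = β₀ + t / √n` the objective `n Q_n(β)` is `(W + B t)ᵀ Σ₀⁻¹ (W + B t) + o_p(1)`,
uniformly for bounded `t`. Only uniform convergence of `Σ_n` and of the Jacobian near `β₀` is needed
for this, and since minimal values rather than minimizers are compared, neither first order
conditions nor second derivatives enter (`HasQuadraticExpansion.tendsto_local`). Away from `β₀` the
objective is bounded below, because `Q_n ≥ c ‖g_n‖²` and `E g` has no other zero. So minimizers
eventually exist and are consistent, and then within `O_p(1 / √n)` of `β₀`. Both minima of `n Q_n`
are therefore, up to `o_p(1)`, the minima of the quadratic form over the corresponding spaces of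
directions `t` (`HasQuadraticExpansion.tendsto_min`).

After whitening by `Σ₀^{-1/2}` these two minima are squared distances to nested subspaces, whose
dimensions differ by `p₁`; they differ by the squared norm of a `p₁`-dimensional projection, that
is by `‖A W‖²` with `A Σ₀ Aᵀ = 1` (`exists_least_squares_difference`). The law of large numbers
identifies `Σ₀` with `E g gᵀ`, so the central limit theorem makes `A W` asymptotically standard
normal and `‖A W‖²` asymptotically chi-squared (`tendstoInDistribution_whitened`).

Statements in probability are phrased with the filter `inProb P` on `ℕ × Ω`, along which `o_p(1)`
means convergence to zero. As `W` is tight, one may restrict this filter to the events `‖W‖ ≤ R`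
(`tendsto_inProb_of_truncated`); there `W` is bounded, and the argument above is deterministic
asymptotic analysis along a filter.
-/

/-! ### Quadratic forms and projections -/

/-- The quadratic form `rᵀ M⁻¹ r`, meaningful where `M` is invertible; `M⁻¹ = 0` otherwise. -/
noncomputable def invQuad {ι : Type*} [Fintype ι] [DecidableEq ι] (M : Matrix ι ι ℝ)
    (r : ι → ℝ) : ℝ :=
  r ⬝ᵥ M⁻¹.mulVec r

section Projection

variable {H : Type*} [NormedAddCommGroup H] [InnerProductSpace ℝ H] [FiniteDimensional ℝ H]

/-- The squared distances from `w` to nested subspaces differ by the squared norm of the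
projection of `w` onto the relative orthogonal complement, here written in an orthonormal basis. -/
theorem exists_orthonormal_dist_sq_sub {V W : Submodule ℝ H} (hVW : V ≤ W) {k : ℕ}
    (hk : Module.finrank ℝ V + k = Module.finrank ℝ W) :
    ∃ e : Fin k → H, Orthonormal ℝ e ∧
      ∀ w, ‖w - V.starProjection w‖ ^ 2 - ‖w - W.starProjection w‖ ^ 2 =
        ∑ i, inner ℝ (e i) w ^ 2 := by
  have hU := Submodule.finrank_add_inf_finrank_orthogonal' hVW hk
  let b := (stdOrthonormalBasis ℝ (Vᗮ ⊓ W : Submodule ℝ H)).reindex (finCongr hU)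
  refine ⟨fun i => (b i : H), ?_, fun w => ?_⟩
  · exact b.orthonormal.comp_linearIsometry (Vᗮ ⊓ W : Submodule ℝ H).subtypeₗᵢ
  have h1 := V.sub_starProjection_mem_orthogonal w
  have h2 := W.sub_starProjection_mem_orthogonal w
  have hd : W.starProjection w - V.starProjection w ∈ (Vᗮ ⊓ W : Submodule ℝ H) := by
    refine ⟨?_, W.sub_mem (W.starProjection_apply_mem w) (hVW (V.starProjection_apply_mem w))⟩
    have : W.starProjection w - V.starProjection w =
      (w - V.starProjection w) - (w - W.starProjection w) := by abel
    rw [this]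
    exact Vᗮ.sub_mem h1 (Submodule.orthogonal_le hVW h2)
  have hpyth : ‖w - V.starProjection w‖ ^ 2 =
      ‖w - W.starProjection w‖ ^ 2 + ‖W.starProjection w - V.starProjection w‖ ^ 2 := by
    have h0 : inner ℝ (w - W.starProjection w) (W.starProjection w - V.starProjection w) = 0 :=
      Submodule.inner_left_of_mem_orthogonal hd.2 h2
    have := norm_add_sq_eq_norm_sq_add_norm_sq_of_inner_eq_zero _ _ h0
    rw [sub_add_sub_cancel] at this
    simpa [sq] using this
  rw [hpyth, add_sub_cancel_left]
  have := b.sum_sq_inner_right ⟨_, hd⟩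
  rw [Submodule.coe_norm] at this
  rw [← this]
  refine Finset.sum_congr rfl fun i _ => ?_
  have hb : (b i : H) ∈ (Vᗮ ⊓ W : Submodule ℝ H) := (b i).2
  have e1 : inner ℝ (b i : H) (w - W.starProjection w) = 0 :=
    Submodule.inner_right_of_mem_orthogonal hb.2 h2
  have e2 : inner ℝ (b i : H) (V.starProjection w) = 0 :=
    Submodule.inner_left_of_mem_orthogonal (V.starProjection_apply_mem w) hb.1
  rw [Submodule.coe_inner, inner_sub_right, e2, sub_zero]
  rw [inner_sub_right, sub_eq_zero] at e1
  rw [e1]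

end Projection

section Minimizers

open scoped MatrixOrder

variable {ι κ : Type*} [Fintype ι] [DecidableEq ι] [Fintype κ]

/-- A matrix `R` that whitens `S`: it turns the norm of `S⁻¹` into the Euclidean norm. -/
theorem Matrix.PosDef.exists_whitening {S : Matrix ι ι ℝ} (hS : S.PosDef) :
    ∃ R : Matrix ι ι ℝ, S⁻¹ = R.transpose * R ∧ R * S * R.transpose = 1 := by
  obtain ⟨R, hR⟩ := CStarAlgebra.nonneg_iff_eq_star_mul_self.mp hS.inv.posSemidef.nonneg
  have hR' : S⁻¹ = R.transpose * R := by
    rw [hR, Matrix.star_eq_conjTranspose, Matrix.conjTranspose_eq_transpose_of_trivial]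
  refine ⟨R, hR', ?_⟩
  have h1 : S * R.transpose * R = 1 := by
    rw [Matrix.mul_assoc, ← hR',
      Matrix.mul_nonsing_inv _ ((Matrix.isUnit_iff_isUnit_det _).1 hS.isUnit)]
  rw [Matrix.mul_assoc]
  exact mul_eq_one_comm.1 h1

/-- Over a subspace `T`, the residual norm `‖u + F t‖` is least at a `t` that is linear in `u`. -/
theorem exists_linear_least_squares {H : Type*} [NormedAddCommGroup H] [InnerProductSpace ℝ H]
    [FiniteDimensional ℝ H] (F : (κ → ℝ) →ₗ[ℝ] H) (T : Submodule ℝ (κ → ℝ)) :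
    ∃ σ : H →ₗ[ℝ] (κ → ℝ), (∀ u, σ u ∈ T) ∧
      (∀ u, ‖u + F (σ u)‖ ^ 2 = ‖u - (T.map F).starProjection u‖ ^ 2) ∧
      ∀ u, ∀ t ∈ T, ‖u + F (σ u)‖ ^ 2 ≤ ‖u + F t‖ ^ 2 := by
  have hsurj : Function.Surjective (F.submoduleMap T) := F.submoduleMap_surjective T
  obtain ⟨ρ, hρ⟩ := LinearMap.exists_rightInverse_of_surjective (F.submoduleMap T)
    (LinearMap.range_eq_top.2 hsurj)
  let V := T.map F
  have hρ' (v : V) : F (ρ v) = v := congrArg Subtype.val (LinearMap.congr_fun hρ v)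
  have hF (u : H) : F (-(ρ (V.orthogonalProjectionOnto u) : κ → ℝ)) = -V.starProjection u := by
    rw [map_neg, hρ']
    rfl
  refine ⟨-(T.subtype ∘ₗ ρ ∘ₗ V.orthogonalProjectionOnto.toLinearMap),
    fun u => T.neg_mem (ρ _).2, fun u => ?_, fun u t ht => ?_⟩
  · exact congrArg (fun v => ‖u + v‖ ^ 2) (hF u) |>.trans (by rw [← sub_eq_add_neg])
  · have h0 : ‖u + F ((-(T.subtype ∘ₗ ρ ∘ₗ V.orthogonalProjectionOnto.toLinearMap)) u)‖ =
        ‖u - V.starProjection u‖ :=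
      congrArg (fun v => ‖u + v‖) (hF u) |>.trans (by rw [← sub_eq_add_neg])
    rw [h0]
    refine pow_le_pow_left₀ (norm_nonneg _) ?_ 2
    rw [Submodule.starProjection_minimal]
    refine (ciInf_le ⟨0, ?_⟩ (⟨-F t, V.neg_mem (Submodule.mem_map_of_mem ht)⟩ : V)).trans_eq ?_
    · rintro _ ⟨x, rfl⟩
      positivity
    · simp

/-- For the norm of `S⁻¹`, the least squares problems over `κ₁ ⊕ κ₂` and over the second block
alone have linear solutions, and their minimal values differ by `‖A w‖²`, where `A` maps a
vector with covariance `S` to one with identity covariance, of dimension the size of the first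
block. -/
theorem exists_least_squares_difference {k : ℕ} {κ₂ : Type*} [Fintype κ₂]
    {S : Matrix ι ι ℝ} (hS : S.PosDef)
    {B : Matrix ι (Fin k ⊕ κ₂) ℝ} (hB : Function.Injective B.mulVec)
    {T : Submodule ℝ (Fin k ⊕ κ₂ → ℝ)} (hT : ∀ t, t ∈ T ↔ ∀ i, t (Sum.inl i) = 0) :
    ∃ (A : Matrix (Fin k) ι ℝ) (τ τ' : (ι → ℝ) →ₗ[ℝ] (Fin k ⊕ κ₂ → ℝ)),
      A * S * A.transpose = 1 ∧
      (∀ w t, invQuad S (w + B.mulVec (τ w)) ≤ invQuad S (w + B.mulVec t)) ∧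
      (∀ w, τ' w ∈ T) ∧
      (∀ w, ∀ t ∈ T, invQuad S (w + B.mulVec (τ' w)) ≤ invQuad S (w + B.mulVec t)) ∧
      ∀ w, invQuad S (w + B.mulVec (τ' w)) - invQuad S (w + B.mulVec (τ w)) =
        ∑ i, (A.mulVec w) i ^ 2 := by
  obtain ⟨R, hR, hRS⟩ := hS.exists_whitening
  let ψ : (ι → ℝ) →ₗ[ℝ] EuclideanSpace ℝ ι :=
    (WithLp.linearEquiv 2 ℝ (ι → ℝ)).symm.toLinearMap ∘ₗ R.mulVecLin
  let F : (Fin k ⊕ κ₂ → ℝ) →ₗ[ℝ] EuclideanSpace ℝ ι := ψ ∘ₗ B.mulVecLin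
  have hψ (r : ι → ℝ) : invQuad S r = ‖ψ r‖ ^ 2 := by
    rw [EuclideanSpace.real_norm_sq_eq]
    have : ∀ i, ψ r i = R.mulVec r i := fun i => rfl
    simp_rw [this, invQuad, hR, ← Matrix.mulVec_mulVec]
    rw [Matrix.dotProduct_mulVec, Matrix.vecMul_transpose]
    simp_rw [dotProduct, sq]
  have hadd (w t) : ψ (w + B.mulVec t) = ψ w + F t := by simp [F]
  have hRinj : Function.Injective R.mulVec := by
    rw [Matrix.mulVec_injective_iff_isUnit]
    rw [Matrix.mul_assoc] at hRS
    exact .of_mul_eq_one _ hRS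
  have hF : Function.Injective F := by
    intro x y hxy
    exact hB (hRinj ((WithLp.linearEquiv 2 ℝ (ι → ℝ)).symm.injective hxy))
  have hfin : Module.finrank ℝ (T.map F) + k = Module.finrank ℝ ((⊤ : Submodule ℝ _).map F) := by
    rw [← (Submodule.equivMapOfInjective F hF _).finrank_eq,
      ← (Submodule.equivMapOfInjective F hF _).finrank_eq]
    have hker : T = LinearMap.ker (LinearMap.funLeft ℝ ℝ (Sum.inl : Fin k → Fin k ⊕ κ₂)) := by
      ext t
      rw [hT, LinearMap.mem_ker, funext_iff]
      rfl
    have := LinearMap.finrank_range_add_finrank_ker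
      (LinearMap.funLeft ℝ ℝ (Sum.inl : Fin k → Fin k ⊕ κ₂))
    rw [LinearMap.range_eq_top.2 (LinearMap.funLeft_surjective_of_injective ℝ ℝ _
      Sum.inl_injective), finrank_top, Module.finrank_fin_fun] at this
    rw [finrank_top, hker, ← this, add_comm]
  obtain ⟨e, he, hdist⟩ := exists_orthonormal_dist_sq_sub (Submodule.map_mono (le_top : T ≤ ⊤)) hfin
  obtain ⟨σ, -, hσ, hσmin⟩ := exists_linear_least_squares F ⊤
  obtain ⟨σ', hσT, hσ', hσmin'⟩ := exists_linear_least_squares F T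
  refine ⟨Matrix.of (fun i j => e i j) * R, σ ∘ₗ ψ, σ' ∘ₗ ψ, ?_, ?_, fun w => hσT _, ?_, ?_⟩
  · have : Matrix.of (fun i j => e i j) * R * S * (Matrix.of (fun i j => e i j) * R).transpose =
        Matrix.of (fun i j => e i j) * (R * S * R.transpose) *
          (Matrix.of (fun i j => e i j)).transpose := by
      simp only [Matrix.transpose_mul, Matrix.mul_assoc]
    rw [this, hRS, Matrix.mul_one]
    ext i j
    have := orthonormal_iff_ite.1 he j i
    rw [PiLp.inner_apply] at this
    simpa [Matrix.mul_apply, Matrix.one_apply, eq_comm] using this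
  · intro w t
    simp only [hψ, hadd]
    exact hσmin _ _ trivial
  · intro w t ht
    simp only [hψ, hadd]
    exact hσmin' _ _ ht
  · intro w
    simp only [hψ, hadd, LinearMap.comp_apply]
    rw [hσ, hσ', hdist]
    refine Finset.sum_congr rfl fun i _ => ?_
    rw [← Matrix.mulVec_mulVec, PiLp.inner_apply]
    simp [Matrix.mulVec, dotProduct, ψ, mul_comm]

end Minimizers

/-! ### Minimum distance estimation along a filter -/

open Asymptotics

section Core

variable {α ι κ : Type*} [Fintype ι] [DecidableEq ι] [Fintype κ]

/-- `b` minimizes `invQuad (S ·) (g ·)` over the points of `C` at which `S` is invertible. -/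
def IsInvQuadMin (C : Set (κ → ℝ)) (g : (κ → ℝ) → ι → ℝ) (S : (κ → ℝ) → Matrix ι ι ℝ)
    (b : κ → ℝ) : Prop :=
  (b ∈ C ∧ IsUnit (S b).det) ∧
    ∀ β ∈ C, IsUnit (S β).det → invQuad (S b) (g b) ≤ invQuad (S β) (g β)

/-- The moments `g` and weights `S`, which depend on an index that runs along the filter `l`,
admit a quadratic expansion at `β₀` with limits `B` and `S₀`, and identify `β₀` in `Θ`. -/
structure HasQuadraticExpansion (l : Filter α) (g : α → (κ → ℝ) → ι → ℝ)
    (S : α → (κ → ℝ) → Matrix ι ι ℝ) (Θ : Set (κ → ℝ)) (β₀ : κ → ℝ)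
    (B : Matrix ι κ ℝ) (S₀ : Matrix ι ι ℝ) : Prop where
  mem_nhds : Θ ∈ 𝓝 β₀
  isUnit : IsUnit S₀.det
  injective : Function.Injective B.mulVec
  continuousOn_moment : ∀ᶠ a in l, ContinuousOn (g a) Θ
  continuousOn_weight : ∀ᶠ a in l, ContinuousOn (S a) Θ
  weight : Tendsto (fun x : α × (κ → ℝ) => S x.1 x.2) (l ×ˢ 𝓝 β₀) (𝓝 S₀)
  expansion : (fun x : α × (κ → ℝ) => g x.1 x.2 - g x.1 β₀ - B.mulVec (x.2 - β₀))
    =o[l ×ˢ 𝓝 β₀] fun x => x.2 - β₀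
  lower : ∃ c > 0, ∀ᶠ a in l, ∀ β ∈ Θ, IsUnit (S a β).det →
    c * ‖g a β‖ ^ 2 ≤ invQuad (S a β) (g a β)
  separated : ∀ U ∈ 𝓝 β₀, ∃ c > 0, ∀ᶠ a in l, ∀ β ∈ Θ \ U, c ≤ ‖g a β‖

theorem HasQuadraticExpansion.mono {l l' : Filter α} {g : α → (κ → ℝ) → ι → ℝ}
    {S : α → (κ → ℝ) → Matrix ι ι ℝ} {Θ : Set (κ → ℝ)} {β₀ : κ → ℝ}
    {B : Matrix ι κ ℝ} {S₀ : Matrix ι ι ℝ} (h : HasQuadraticExpansion l g S Θ β₀ B S₀)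
    (hl : l' ≤ l) : HasQuadraticExpansion l' g S Θ β₀ B S₀ where
  mem_nhds := h.mem_nhds
  isUnit := h.isUnit
  injective := h.injective
  continuousOn_moment := h.continuousOn_moment.filter_mono hl
  continuousOn_weight := h.continuousOn_weight.filter_mono hl
  weight := h.weight.mono_left (Filter.prod_mono_left _ hl)
  expansion := h.expansion.mono (Filter.prod_mono_left _ hl)
  lower := by
    obtain ⟨c, hc, h⟩ := h.lower
    exact ⟨c, hc, h.filter_mono hl⟩
  separated U hU := by
    obtain ⟨c, hc, h⟩ := h.separated U hU
    exact ⟨c, hc, h.filter_mono hl⟩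

theorem invQuad_smul (M : Matrix ι ι ℝ) (c : ℝ) (r : ι → ℝ) :
    invQuad M (c • r) = c ^ 2 * invQuad M r := by
  simp only [invQuad, Matrix.mulVec_smul, dotProduct_smul, smul_dotProduct, smul_eq_mul]
  ring

theorem tendsto_matrix_inv {l : Filter α} {M : α → Matrix ι ι ℝ} {M₀ : Matrix ι ι ℝ}
    (h : Tendsto M l (𝓝 M₀)) (hM₀ : IsUnit M₀.det) :
    Tendsto (fun a => (M a)⁻¹) l (𝓝 M₀⁻¹) := by
  refine (continuousAt_matrix_inv M₀ ?_).tendsto.comp h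
  rw [Ring.inverse_eq_inv']
  exact continuousAt_inv₀ hM₀.ne_zero

omit [DecidableEq ι] in
theorem tendsto_dotProduct_mulVec_zero_left {l : Filter α} {u v : α → ι → ℝ}
    {M : α → Matrix ι ι ℝ} {M₀ : Matrix ι ι ℝ} (hu : Tendsto u l (𝓝 0))
    (hM : Tendsto M l (𝓝 M₀)) (hv : v =O[l] fun _ => (1 : ℝ)) :
    Tendsto (fun a => u a ⬝ᵥ (M a).mulVec (v a)) l (𝓝 0) := by
  have key (i j : ι) : Tendsto (fun a => u a i * (M a i j * v a j)) l (𝓝 0) := by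
    have h1 : (fun a => u a i) =o[l] fun _ => (1 : ℝ) :=
      (isLittleO_one_iff ℝ).2 (tendsto_pi_nhds.1 hu i)
    have h2 : (fun a => M a i j) =O[l] fun _ => (1 : ℝ) :=
      (tendsto_pi_nhds.1 (tendsto_pi_nhds.1 hM i) j).isBigO_one ℝ
    have h3 : (fun a => v a j) =O[l] fun _ => (1 : ℝ) := isBigO_pi.1 hv j
    have := h1.mul_isBigO (h2.mul h3)
    simpa using this
  have := tendsto_finsetSum Finset.univ fun i _ =>
    tendsto_finsetSum Finset.univ fun j _ => key i j
  simpa [dotProduct, Matrix.mulVec, Finset.mul_sum] using this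

omit [DecidableEq ι] in
theorem tendsto_dotProduct_mulVec_zero_right {l : Filter α} {u v : α → ι → ℝ}
    {M : α → Matrix ι ι ℝ} {M₀ : Matrix ι ι ℝ} (hu : u =O[l] fun _ => (1 : ℝ))
    (hM : Tendsto M l (𝓝 M₀)) (hv : Tendsto v l (𝓝 0)) :
    Tendsto (fun a => u a ⬝ᵥ (M a).mulVec (v a)) l (𝓝 0) := by
  have hMt : Tendsto (fun a => (M a).transpose) l (𝓝 M₀.transpose) :=
    ((continuous_id.matrix_transpose).tendsto M₀).comp hM
  refine (tendsto_dotProduct_mulVec_zero_left hv hMt hu).congr fun a => ?_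
  rw [Matrix.mulVec_transpose, Matrix.dotProduct_mulVec, dotProduct_comm]

/-- `invQuad` is uniformly continuous on bounded sets, jointly with its matrix at an invertible
one. -/
theorem tendsto_invQuad_sub {l : Filter α} {M : α → Matrix ι ι ℝ} {M₀ : Matrix ι ι ℝ}
    {r r' : α → ι → ℝ} (hM : Tendsto M l (𝓝 M₀)) (hM₀ : IsUnit M₀.det)
    (hr : r' =O[l] fun _ => (1 : ℝ)) (hrr : Tendsto (fun a => r a - r' a) l (𝓝 0)) :
    Tendsto (fun a => invQuad (M a) (r a) - invQuad M₀ (r' a)) l (𝓝 0) := by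
  have hinv := tendsto_matrix_inv hM hM₀
  have hr' : r =O[l] fun _ => (1 : ℝ) := by
    have := (hrr.isBigO_one ℝ).add hr
    simpa using this
  have hdiff : Tendsto (fun a => (M a)⁻¹ - M₀⁻¹) l (𝓝 0) := by
    simpa using hinv.sub_const M₀⁻¹
  have hmul : Tendsto (fun a => ((M a)⁻¹ - M₀⁻¹).mulVec (r' a)) l (𝓝 0) := by
    rw [tendsto_pi_nhds]
    intro i
    have key (j : ι) : Tendsto (fun a => ((M a)⁻¹ - M₀⁻¹) i j * r' a j) l (𝓝 0) := by
      have h1 : (fun a => ((M a)⁻¹ - M₀⁻¹) i j) =o[l] fun _ => (1 : ℝ) :=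
        (isLittleO_one_iff ℝ).2 (tendsto_pi_nhds.1 (tendsto_pi_nhds.1 hdiff i) j)
      simpa using h1.mul_isBigO (isBigO_pi.1 hr j)
    simpa [Matrix.mulVec, dotProduct] using tendsto_finsetSum Finset.univ fun j _ => key j
  have h1 := tendsto_dotProduct_mulVec_zero_left hrr hinv hr'
  have h2 := tendsto_dotProduct_mulVec_zero_right hr hinv hrr
  have h3 := tendsto_dotProduct_mulVec_zero_right hr
    (tendsto_const_nhds (x := (1 : Matrix ι ι ℝ))) hmul
  have := (h1.add h2).add h3
  simp only [add_zero] at this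
  refine this.congr fun a => ?_
  simp only [invQuad, Matrix.one_mulVec, sub_dotProduct, Matrix.mulVec_sub, dotProduct_sub,
    Matrix.sub_mulVec]
  ring

omit [DecidableEq ι] in
theorem isBigO_mulVec {l : Filter α} (B : Matrix ι κ ℝ) {t : α → κ → ℝ} {f : α → ℝ}
    (ht : t =O[l] f) : (fun a => B.mulVec (t a)) =O[l] f :=
  (B.mulVecLin.toContinuousLinearMap.isBigO_comp t l).trans ht

omit [DecidableEq ι] in
theorem isBigO_of_mulVec_injective {B : Matrix ι κ ℝ} (hB : Function.Injective B.mulVec)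
    {l : Filter α} (t : α → κ → ℝ) : t =O[l] fun a => B.mulVec (t a) := by
  obtain ⟨K, -, hK⟩ := B.mulVecLin.exists_antilipschitzWith (LinearMap.ker_eq_bot.2 hB)
  exact .of_bound K (.of_forall fun a => by simpa using hK.le_mul_norm_sub (t a) 0)

theorem isBigO_invQuad {l : Filter α} (M : Matrix ι ι ℝ) {r : α → ι → ℝ}
    (hr : r =O[l] fun _ => (1 : ℝ)) : (fun a => invQuad M (r a)) =O[l] fun _ => (1 : ℝ) := by
  simp only [invQuad, dotProduct]
  have key (i : ι) : (fun a => r a i * M⁻¹.mulVec (r a) i) =O[l] fun _ => (1 : ℝ) := by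
    have h1 : (fun a => r a i) =O[l] fun _ => (1 : ℝ) := isBigO_pi.1 hr i
    have h2 : (fun a => M⁻¹.mulVec (r a) i) =O[l] fun _ => (1 : ℝ) :=
      isBigO_pi.1 (isBigO_mulVec M⁻¹ hr) i
    simpa using h1.mul h2
  exact IsBigO.fun_sum fun i _ => key i

variable {l : Filter α} {g : α → (κ → ℝ) → ι → ℝ}
  {S : α → (κ → ℝ) → Matrix ι ι ℝ} {Θ : Set (κ → ℝ)} {β₀ : κ → ℝ}
  {B : Matrix ι κ ℝ} {S₀ : Matrix ι ι ℝ} {N : α → ℝ} {b : α → κ → ℝ}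

theorem HasQuadraticExpansion.isLittleO_remainder (h : HasQuadraticExpansion l g S Θ β₀ B S₀)
    (hb : Tendsto b l (𝓝 β₀)) (N : α → ℝ) :
    (fun a => N a • g a (b a) - N a • g a β₀ - B.mulVec (N a • (b a - β₀)))
      =o[l] fun a => N a • (b a - β₀) := by
  have := h.expansion.comp_tendsto (tendsto_id.prodMk hb)
  have := (isBigO_refl N l).smul_isLittleO this
  refine this.congr_left fun a => ?_
  simp only [Function.comp_apply, id, smul_sub, Matrix.mulVec_sub, Matrix.mulVec_smul]

/-- At distance `O(1 / N)` from `β₀`, the rescaled objective is the limiting quadratic form. -/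
theorem HasQuadraticExpansion.tendsto_local (h : HasQuadraticExpansion l g S Θ β₀ B S₀)
    (hN : Tendsto N l atTop) (hw : (fun a => N a • g a β₀) =O[l] fun _ => (1 : ℝ))
    (ht : (fun a => N a • (b a - β₀)) =O[l] fun _ => (1 : ℝ)) :
    Tendsto b l (𝓝 β₀) ∧
    Tendsto (fun a => N a ^ 2 * invQuad (S a (b a)) (g a (b a)) -
      invQuad S₀ (N a • g a β₀ + B.mulVec (N a • (b a - β₀)))) l (𝓝 0) := by
  have hb : Tendsto b l (𝓝 β₀) := by
    have h1 : (fun a => (N a)⁻¹) =o[l] fun _ => (1 : ℝ) :=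
      (isLittleO_one_iff ℝ).2 hN.inv_tendsto_atTop
    have h2 := h1.smul_isBigO ht
    simp only [smul_eq_mul, mul_one] at h2
    rw [isLittleO_one_iff] at h2
    rw [← tendsto_sub_nhds_zero_iff]
    refine h2.congr' ?_
    filter_upwards [hN.eventually_ne_atTop 0] with a ha
    rw [inv_smul_smul₀ ha]
  refine ⟨hb, ?_⟩
  have hrem := (isLittleO_one_iff ℝ).1 ((h.isLittleO_remainder hb N).trans_isBigO ht)
  have hS : Tendsto (fun a => S a (b a)) l (𝓝 S₀) := h.weight.comp (tendsto_id.prodMk hb)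
  have := tendsto_invQuad_sub (r := fun a => N a • g a (b a)) hS h.isUnit
    (hw.add (isBigO_mulVec B ht)) (by simpa only [sub_sub] using hrem)
  simpa only [invQuad_smul] using this

/-- If the rescaled objective stays bounded at a consistent `b`, then `b` is at distance
`O(1 / N)` from `β₀`. -/
theorem HasQuadraticExpansion.isBigO_rate (h : HasQuadraticExpansion l g S Θ β₀ B S₀)
    (hw : (fun a => N a • g a β₀) =O[l] fun _ => (1 : ℝ))
    (hb : Tendsto b l (𝓝 β₀))
    (hQ : (fun a => N a ^ 2 * invQuad (S a (b a)) (g a (b a))) =O[l] fun _ => (1 : ℝ)) :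
    (fun a => N a • (b a - β₀)) =O[l] fun _ => (1 : ℝ) := by
  have hS : Tendsto (fun a => S a (b a)) l (𝓝 S₀) := h.weight.comp (tendsto_id.prodMk hb)
  obtain ⟨c, hc, hlow⟩ := h.lower
  have hr : (fun a => N a • g a (b a)) =O[l] fun _ => (1 : ℝ) := by
    have hdet : ∀ᶠ a in l, (S a (b a)).det ≠ 0 :=
      ((continuous_id.matrix_det.tendsto S₀).comp hS).eventually_ne h.isUnit.ne_zero
    have h2 : (fun a => ‖N a • g a (b a)‖ ^ 2) =O[l] fun _ => (1 : ℝ) ^ 2 := by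
      rw [one_pow]
      refine (IsBigO.of_bound c⁻¹ ?_).trans hQ
      filter_upwards [hlow, hdet, hb.eventually h.mem_nhds] with a ha hd hm
      have := ha _ hm (isUnit_iff_ne_zero.2 hd)
      rw [norm_pow, norm_norm, norm_smul, mul_pow, Real.norm_eq_abs, sq_abs,
        inv_mul_eq_div, le_div_iff₀ hc]
      refine le_trans ?_ (le_abs_self _)
      calc _ = N a ^ 2 * (c * ‖g a (b a)‖ ^ 2) := by ring
        _ ≤ _ := by gcongr
    exact ((IsBigO.of_pow two_ne_zero h2)).of_norm_left
  have h1 := (h.isLittleO_remainder hb N).trans_isBigO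
    (isBigO_of_mulVec_injective h.injective fun a => N a • (b a - β₀))
  have h2 : (fun a => N a • g a (b a) - N a • g a β₀) =O[l] fun _ => (1 : ℝ) := hr.sub hw
  -- the remainder is `o(B t)`, so `B t` is of the order of `B t` plus the remainder
  have h3 := h1.right_isBigO_add
  simp only [sub_add_cancel] at h3
  exact (isBigO_of_mulVec_injective h.injective _).trans (h3.trans h2)

/-- Eventually a minimizer exists, and every minimizer is close to `β₀`: the objective is bounded
below away from `β₀`, and small at `β₀`. -/
theorem HasQuadraticExpansion.eventually_exists_min
    (h : HasQuadraticExpansion l g S Θ β₀ B S₀)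
    {C : Set (κ → ℝ)} (hC : IsClosed C) (hβ₀ : β₀ ∈ C) (hg : Tendsto (fun a => g a β₀) l (𝓝 0))
    {U : Set (κ → ℝ)} (hU : U ∈ 𝓝 β₀) :
    ∀ᶠ a in l, (∃ b, IsInvQuadMin (Θ ∩ C) (g a) (S a) b) ∧
      ∀ b, IsInvQuadMin (Θ ∩ C) (g a) (S a) b → b ∈ U := by
  have hdet : ∀ᶠ x : α × (κ → ℝ) in l ×ˢ 𝓝 β₀, (S x.1 x.2).det ≠ 0 :=
    ((continuous_id.matrix_det.tendsto S₀).comp h.weight).eventually_ne h.isUnit.ne_zero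
  obtain ⟨pa, hpa, pb, hpb, hpab⟩ := eventually_prod_iff.1 hdet
  obtain ⟨ε, hε, hball⟩ := Metric.nhds_basis_closedBall.mem_iff.1
    (inter_mem (inter_mem hU h.mem_nhds) hpb)
  obtain ⟨c, hc, hsep⟩ := h.separated _ (Metric.closedBall_mem_nhds β₀ hε)
  obtain ⟨c', hc', hlow⟩ := h.lower
  have hS₀ : Tendsto (fun a => S a β₀) l (𝓝 S₀) :=
    h.weight.comp (tendsto_id.prodMk tendsto_const_nhds)
  have hQ₀ : Tendsto (fun a => invQuad (S a β₀) (g a β₀)) l (𝓝 0) :=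
    tendsto_dotProduct_mulVec_zero_left hg (tendsto_matrix_inv hS₀ h.isUnit) (hg.isBigO_one ℝ)
  filter_upwards [hpa, hsep, hlow, h.continuousOn_moment, h.continuousOn_weight,
    hQ₀.eventually_lt_const (show 0 < c' * c ^ 2 by positivity)] with a ha hsep hlow hcg hcS hQ
  -- outside the ball the objective exceeds its value at `β₀`
  have hout : ∀ β ∈ Θ, IsUnit (S a β).det → invQuad (S a β) (g a β) ≤ invQuad (S a β₀) (g a β₀) →
      β ∈ Metric.closedBall β₀ ε := by
    intro β hβ hu hle
    by_contra hn
    have h1 := hsep β ⟨hβ, hn⟩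
    have h2 := hlow β hβ hu
    have h3 : c' * c ^ 2 ≤ c' * ‖g a β‖ ^ 2 := by gcongr
    linarith
  have hβ₀Θ : β₀ ∈ Θ := mem_of_mem_nhds h.mem_nhds
  have hunit : ∀ β ∈ Metric.closedBall β₀ ε, IsUnit (S a β).det := fun β hβ =>
    isUnit_iff_ne_zero.2 (hpab ha (hball hβ).2)
  have hβ₀ball := Metric.mem_closedBall_self (x := β₀) hε.le
  constructor
  · have hsub : Metric.closedBall β₀ ε ∩ C ⊆ Θ := fun β hβ => (hball hβ.1).1.2
    have hcont : ContinuousOn (fun β => invQuad (S a β) (g a β)) (Metric.closedBall β₀ ε ∩ C) := by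
      have h1 := hcg.mono hsub
      have h2 := hcS.mono hsub
      intro β hβ
      have h3 : Tendsto (fun β => (S a β)⁻¹) (𝓝[Metric.closedBall β₀ ε ∩ C] β) (𝓝 (S a β)⁻¹) :=
        tendsto_matrix_inv (h2 β hβ) (hunit β hβ.1)
      have h4 := fun i => tendsto_pi_nhds.1 (h1 β hβ) i
      have h5 := fun i j => tendsto_pi_nhds.1 (tendsto_pi_nhds.1 h3 i) j
      simp only [ContinuousWithinAt, invQuad, dotProduct, Matrix.mulVec]
      exact tendsto_finsetSum _ fun i _ => (h4 i).mul
        (tendsto_finsetSum _ fun j _ => (h5 i j).mul (h4 j))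
    obtain ⟨b, hb, hmin⟩ := ((isCompact_closedBall β₀ ε).inter_right hC).exists_isMinOn
      ⟨β₀, hβ₀ball, hβ₀⟩ hcont
    refine ⟨b, ⟨⟨hsub hb, hb.2⟩, hunit b hb.1⟩, fun β hβ hu => ?_⟩
    by_cases hle : invQuad (S a β) (g a β) ≤ invQuad (S a β₀) (g a β₀)
    · exact hmin ⟨hout β hβ.1 hu hle, hβ.2⟩
    · exact (hmin ⟨hβ₀ball, hβ₀⟩).trans (not_le.1 hle).le
  · intro b hb
    exact (hball (hout b hb.1.1.1 hb.1.2 (hb.2 β₀ ⟨hβ₀Θ, hβ₀⟩ (hunit β₀ hβ₀ball)))).1.1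

/-- The rescaled minimum over `β₀ + T` is asymptotically the minimum over `T` of the limiting
quadratic form. -/
theorem HasQuadraticExpansion.tendsto_min
    (h : HasQuadraticExpansion l g S Θ β₀ B S₀)
    (hN : Tendsto N l atTop) (hw : (fun a => N a • g a β₀) =O[l] fun _ => (1 : ℝ))
    (T : Submodule ℝ (κ → ℝ)) {τ : (ι → ℝ) →ₗ[ℝ] (κ → ℝ)} (hτ : ∀ w, τ w ∈ T)
    (hmin : ∀ w, ∀ t ∈ T, invQuad S₀ (w + B.mulVec (τ w)) ≤ invQuad S₀ (w + B.mulVec t))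
    (hb : ∀ᶠ a in l, (∃ b, IsInvQuadMin (Θ ∩ {β | β - β₀ ∈ T}) (g a) (S a) b) →
      IsInvQuadMin (Θ ∩ {β | β - β₀ ∈ T}) (g a) (S a) (b a)) :
    Tendsto (fun a => N a ^ 2 * invQuad (S a (b a)) (g a (b a)) -
      invQuad S₀ (N a • g a β₀ + B.mulVec (τ (N a • g a β₀)))) l (𝓝 0) := by
  have hC : IsClosed {β | β - β₀ ∈ T} :=
    T.closed_of_finiteDimensional.preimage (continuous_id.sub continuous_const)
  have hβ₀ : β₀ ∈ {β | β - β₀ ∈ T} := by simp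
  have hg : Tendsto (fun a => g a β₀) l (𝓝 0) := by
    have h1 : (fun a => (N a)⁻¹) =o[l] fun _ => (1 : ℝ) :=
      (isLittleO_one_iff ℝ).2 hN.inv_tendsto_atTop
    have h2 := h1.smul_isBigO hw
    simp only [smul_eq_mul, mul_one] at h2
    rw [isLittleO_one_iff] at h2
    refine h2.congr' ?_
    filter_upwards [hN.eventually_ne_atTop 0] with a ha
    rw [inv_smul_smul₀ ha]
  have hbmin : ∀ᶠ a in l, IsInvQuadMin (Θ ∩ {β | β - β₀ ∈ T}) (g a) (S a) (b a) := by
    filter_upwards [hb, h.eventually_exists_min hC hβ₀ hg univ_mem] with a h1 h2 using h1 h2.1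
  have hbβ₀ : Tendsto b l (𝓝 β₀) := by
    refine tendsto_def.2 fun U hU => ?_
    filter_upwards [hbmin, h.eventually_exists_min hC hβ₀ hg hU] with a h1 h2 using h2.2 _ h1
  -- any sequence `β₀ + O(1 / N)` in the constraint set is a competitor
  have hcomp : ∀ {b' : α → κ → ℝ}, (∀ a, b' a - β₀ ∈ T) → Tendsto b' l (𝓝 β₀) →
      ∀ᶠ a in l, N a ^ 2 * invQuad (S a (b a)) (g a (b a)) ≤
        N a ^ 2 * invQuad (S a (b' a)) (g a (b' a)) := by
    intro b' hT hb'
    have hS : Tendsto (fun a => S a (b' a)) l (𝓝 S₀) := h.weight.comp (tendsto_id.prodMk hb')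
    have hdet : ∀ᶠ a in l, (S a (b' a)).det ≠ 0 :=
      ((continuous_id.matrix_det.tendsto S₀).comp hS).eventually_ne h.isUnit.ne_zero
    filter_upwards [hbmin, hdet, hb'.eventually h.mem_nhds] with a h1 h2 h3
    gcongr
    exact h1.2 _ ⟨h3, hT a⟩ (isUnit_iff_ne_zero.2 h2)
  have hQb : (fun a => N a ^ 2 * invQuad (S a (b a)) (g a (b a))) =O[l] fun _ => (1 : ℝ) := by
    have h0 := (h.tendsto_local (b := fun _ => β₀) hN hw 
      (by simpa only [sub_self, smul_zero] using isBigO_zero _ _)).2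
    have h1 : (fun a => N a ^ 2 * invQuad (S a β₀) (g a β₀)) =O[l] fun _ => (1 : ℝ) := by
      have := (h0.isBigO_one ℝ).add (isBigO_invQuad S₀ hw)
      simpa using this
    obtain ⟨c, hc, hlow⟩ := h.lower
    refine (IsBigO.of_bound 1 ?_).trans h1
    filter_upwards [hcomp (b' := fun _ => β₀) (by simp) tendsto_const_nhds, hlow, hbmin]
      with a h2 h3 h4
    have h5 : 0 ≤ N a ^ 2 * invQuad (S a (b a)) (g a (b a)) :=
      mul_nonneg (sq_nonneg _) (le_trans (by positivity) (h3 _ h4.1.1.1 h4.1.2))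
    rw [one_mul, Real.norm_of_nonneg h5]
    exact h2.trans (le_abs_self _)
  have ht := h.isBigO_rate hw hbβ₀ hQb
  have hlo := (h.tendsto_local hN hw ht).2
  let b' : α → κ → ℝ := fun a => β₀ + (N a)⁻¹ • τ (N a • g a β₀)
  have hNb' : ∀ᶠ a in l, N a • (b' a - β₀) = τ (N a • g a β₀) := by
    filter_upwards [hN.eventually_ne_atTop 0] with a ha
    simp [b', ha]
  have hτO : (fun a => τ (N a • g a β₀)) =O[l] fun _ => (1 : ℝ) :=
    (τ.toContinuousLinearMap.isBigO_comp _ l).trans hw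
  obtain ⟨hb'β₀, hup⟩ := h.tendsto_local (b := b') hN hw (hτO.congr' (hNb'.mono fun _ h => h.symm)
    EventuallyEq.rfl)
  refine tendsto_of_tendsto_of_tendsto_of_le_of_le' hlo hup ?_ ?_
  · filter_upwards [hbmin] with a ha
    have := hmin (N a • g a β₀) _ (T.smul_mem (N a) ha.1.1.2)
    linarith
  · have hT : ∀ a, b' a - β₀ ∈ T := fun a => by
      simpa only [b', add_sub_cancel_left] using T.smul_mem _ (hτ _)
    filter_upwards [hNb', hcomp hT hb'β₀] with a h1 h2
    rw [h1] at *
    linarith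

end Core

/-! ### Convergence in probability as a filter -/

section InProb

variable {Ω : Type*} [MeasurableSpace Ω]

/-- The filter on `ℕ × Ω` of the sequences of events whose probability tends to one. Convergence
along it is convergence in probability. -/
def inProb (P : Measure Ω) : Filter (ℕ × Ω) where
  sets := {A | Tendsto (fun n => P {ω | (n, ω) ∉ A}) atTop (𝓝 0)}
  univ_sets := by simp
  sets_of_superset {A B} hA hAB :=
    tendsto_of_tendsto_of_tendsto_of_le_of_le tendsto_const_nhds hA (fun _ => zero_le)
      fun n => measure_mono fun ω (hω : (n, ω) ∉ B) h => hω (hAB h)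
  inter_sets {A B} hA hB := by
    have := Tendsto.add hA hB
    rw [add_zero] at this
    refine tendsto_of_tendsto_of_tendsto_of_le_of_le tendsto_const_nhds this (fun _ => zero_le)
      fun n => (measure_mono fun ω (hω : (n, ω) ∉ A ∩ B) => ?_).trans (measure_union_le _ _)
    exact not_and_or.1 hω

variable {P : Measure Ω}

theorem eventually_inProb {p : ℕ × Ω → Prop} :
    (∀ᶠ x in inProb P, p x) ↔ Tendsto (fun n => P {ω | ¬ p (n, ω)}) atTop (𝓝 0) :=
  Iff.rfl

theorem eventually_inProb_of_ae {p : ℕ → Ω → Prop} (h : ∀ n, ∀ᵐ ω ∂P, p n ω) :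
    ∀ᶠ x in inProb P, p x.1 x.2 := by
  rw [eventually_inProb]
  exact tendsto_const_nhds.congr fun n => (ae_iff.1 (h n)).symm

theorem tendsto_fst_inProb : Tendsto Prod.fst (inProb P) atTop := by
  refine tendsto_def.2 fun s hs => eventually_inProb.2 ?_
  refine tendsto_const_nhds.congr' ?_
  filter_upwards [hs] with n hn
  simp [hn]

instance [IsProbabilityMeasure P] : (inProb P).NeBot := by
  refine ⟨fun h => ?_⟩
  have h0 : ∀ᶠ _ in inProb P, False := by
    rw [h]
    exact eventually_bot
  rw [eventually_inProb] at h0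
  simp at h0

theorem tendsto_inProb_of_tendstoInMeasure {X : ℕ → Ω → ℝ} {c : ℝ}
    (h : TendstoInMeasure P X atTop fun _ => c) :
    Tendsto (fun x : ℕ × Ω => X x.1 x.2) (inProb P) (𝓝 c) := by
  rw [Metric.tendsto_nhds]
  intro ε hε
  rw [eventually_inProb]
  simpa using (tendstoInMeasure_iff_dist.1 h) ε hε

theorem tendstoInMeasure_of_tendsto_inProb {X : ℕ → Ω → ℝ} {c : ℝ}
    (h : Tendsto (fun x : ℕ × Ω => X x.1 x.2) (inProb P) (𝓝 c)) :
    TendstoInMeasure P X atTop fun _ => c := by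
  rw [tendstoInMeasure_iff_dist]
  intro ε hε
  have := Metric.tendsto_nhds.1 h ε hε
  rw [eventually_inProb] at this
  simpa using this

theorem UnifLittleOP.eventually {B : Type*} {V : Set B} {F : ℕ → Ω → B → ℝ}
    (h : UnifLittleOP P V F) {δ : ℝ} (hδ : 0 < δ) :
    ∀ᶠ x in inProb P, ∀ β ∈ V, F x.1 x.2 β < δ := by
  rw [eventually_inProb]
  simpa using h δ hδ

/-- To show `X = o_p(1)` one may truncate at `‖W‖ ≤ R`, for any tight `W`. -/
theorem tendsto_inProb_of_truncated {E : Type*} [Norm E] {W : ℕ × Ω → E}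
    (hW : ∀ ε : ENNReal, 0 < ε → ∃ R : ℝ, ∀ n, P {ω | R < ‖W (n, ω)‖} ≤ ε) {X : ℕ × Ω → ℝ}
    (hX : ∀ R : ℝ, Tendsto X (inProb P ⊓ 𝓟 {x | ‖W x‖ ≤ R}) (𝓝 0)) :
    Tendsto X (inProb P) (𝓝 0) := by
  refine tendsto_def.2 fun U hU => eventually_inProb.2 (ENNReal.tendsto_nhds_zero.2 fun ε hε => ?_)
  obtain ⟨R, hR⟩ := hW (ε / 2) (ENNReal.half_pos hε.ne')
  have h1 := eventually_inf_principal.1 ((hX R).eventually hU)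
  rw [eventually_inProb] at h1
  filter_upwards [ENNReal.tendsto_nhds_zero.1 h1 (ε / 2) (ENNReal.half_pos hε.ne')] with n hn
  calc P {ω | (n, ω) ∉ X ⁻¹' U}
      ≤ P ({ω | ¬ ((n, ω) ∈ {x | ‖W x‖ ≤ R} → X (n, ω) ∈ U)} ∪ {ω | R < ‖W (n, ω)‖}) := by
        refine measure_mono fun ω hω => ?_
        by_cases h : ‖W (n, ω)‖ ≤ R
        · exact Or.inl fun h' => hω (h' h)
        · exact Or.inr (not_le.1 h)
    _ ≤ ε / 2 + ε / 2 := (measure_union_le _ _).trans (add_le_add hn (hR n))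
    _ = ε := ENNReal.add_halves ε

end InProb

/-! ### Limit theorems for independent, identically distributed variables -/

section LimitTheorems

variable {Ω : Type*} [MeasurableSpace Ω] {P : Measure Ω} [IsProbabilityMeasure P]

theorem tendsto_inProb_average {X : ℕ → Ω → ℝ} (hint : Integrable (X 0) P)
    (hindep : iIndepFun X P) (hident : ∀ i, IdentDistrib (X i) (X 0) P P) :
    Tendsto (fun x : ℕ × Ω => (x.1 : ℝ)⁻¹ * ∑ i ∈ Finset.range x.1, X i x.2) (inProb P)
      (𝓝 (∫ ω, X 0 ω ∂P)) := by
  refine tendsto_inProb_of_tendstoInMeasure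
    (X := fun n ω => (n : ℝ)⁻¹ * ∑ i ∈ Finset.range n, X i ω)
    (tendstoInMeasure_of_tendsto_ae (fun n => ?_) ?_)
  · exact ((Finset.aemeasurable_fun_sum _ fun i _ =>
      (hident i).aemeasurable_fst).const_mul _).aestronglyMeasurable
  · filter_upwards [strong_law_ae_real X hint (fun i j hij => hindep.indepFun hij) hident]
      with ω hω
    simpa only [inv_mul_eq_div] using hω

/-- Chebyshev's inequality: normalized sums of centred variables are tight. -/
theorem tight_normalized_sum {X : ℕ → Ω → ℝ} (hX : MemLp (X 0) 2 P) (h0 : ∫ ω, X 0 ω ∂P = 0)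
    (hindep : iIndepFun X P) (hident : ∀ i, IdentDistrib (X i) (X 0) P P)
    (ε : ENNReal) (hε : 0 < ε) :
    ∃ R : ℝ, ∀ n : ℕ,
      P {ω | R < |√n * ((n : ℝ)⁻¹ * ∑ i ∈ Finset.range n, X i ω)|} ≤ ε := by
  have hmem (i : ℕ) : MemLp (X i) 2 P := (hident i).memLp_iff.2 hX
  have hlim : Tendsto (fun R : ℝ => ENNReal.ofReal (Var[X 0; P] / R ^ 2)) atTop (𝓝 0) := by
    rw [← ENNReal.ofReal_zero]
    exact (ENNReal.continuous_ofReal.tendsto 0).comp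
      (tendsto_const_nhds.div_atTop (tendsto_pow_atTop two_ne_zero))
  obtain ⟨R, hR, hRpos⟩ := ((ENNReal.tendsto_nhds_zero.1 hlim ε hε).and
    (eventually_gt_atTop 0)).exists
  refine ⟨R, fun n => ?_⟩
  let c : ℝ := √n * (n : ℝ)⁻¹
  have hsum : MemLp (fun ω => c * (∑ i ∈ Finset.range n, X i) ω) 2 P :=
    (memLp_finsetSum' _ fun i _ => hmem i).const_mul c
  have hmean : ∫ ω, c * (∑ i ∈ Finset.range n, X i) ω ∂P = 0 := by
    simp only [Finset.sum_apply]
    rw [integral_const_mul, integral_finsetSum _ fun i _ => (hmem i).integrable (by norm_num)]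
    simp [fun i => (hident i).integral_eq, h0]
  have hvar : Var[fun ω => c * (∑ i ∈ Finset.range n, X i) ω; P] ≤ Var[X 0; P] := by
    rw [variance_const_mul, IndepFun.variance_sum (fun i _ => hmem i)
      fun i _ j _ hij => hindep.indepFun hij]
    simp only [fun i => (hident i).variance_eq, Finset.sum_const, Finset.card_range, nsmul_eq_mul]
    have hc : c ^ 2 * n ≤ 1 := by
      rcases eq_or_ne (n : ℝ) 0 with h | h
      · simp [h]
      · rw [mul_pow, Real.sq_sqrt (Nat.cast_nonneg n)]
        field_simp
        exact le_rfl
    have hv := variance_nonneg (X 0) P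
    rw [← mul_assoc]
    nlinarith
  have hcheb := meas_ge_le_variance_div_sq hsum hRpos
  rw [hmean] at hcheb
  calc _ ≤ P {ω | R ≤ |c * (∑ i ∈ Finset.range n, X i) ω - 0|} := by
        refine measure_mono fun ω (hω : R < _) => ?_
        simp only [Set.mem_ofPred_eq, sub_zero, Finset.sum_apply, c, mul_assoc]
        exact hω.le
    _ ≤ _ := hcheb
    _ ≤ ENNReal.ofReal (Var[X 0; P] / R ^ 2) := by gcongr
    _ ≤ ε := hR

/-- The central limit theorem for vectors with identity covariance, via Lévy's theorem and the
one-dimensional theorem for linear combinations. -/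
theorem tendstoInDistribution_normalized_sum {k : ℕ} {Z : ℕ → Ω → Fin k → ℝ}
    (hindep : iIndepFun Z P) (hident : ∀ i, IdentDistrib (Z i) (Z 0) P P)
    (hL2 : ∀ a, MemLp (fun ω => Z 0 ω a) 2 P) (h0 : ∀ a, ∫ ω, Z 0 ω a ∂P = 0)
    (hcov : ∀ a b, ∫ ω, Z 0 ω a * Z 0 ω b ∂P = (1 : Matrix (Fin k) (Fin k) ℝ) a b) :
    TendstoInDistribution (fun (n : ℕ) (ω : Ω) =>
        WithLp.toLp 2 fun a => (√n)⁻¹ * ∑ i ∈ Finset.range n, Z i ω a)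
      atTop (WithLp.toLp 2 : (Fin k → ℝ) → EuclideanSpace ℝ (Fin k)) (fun _ => P)
      (Measure.pi fun _ => gaussianReal 0 1) where
  forall_aemeasurable n := by
    have (i : ℕ) : AEMeasurable (Z i) P := (hident i).aemeasurable_fst
    refine (WithLp.measurable_toLp 2 _).comp_aemeasurable (aemeasurable_pi_lambda _ fun a => ?_)
    exact (Finset.aemeasurable_fun_sum _ fun i _ =>
      (measurable_pi_apply a).comp_aemeasurable (this i)).const_mul _
  aemeasurable_limit := (WithLp.measurable_toLp 2 _).aemeasurable
  tendsto := by
    refine ProbabilityMeasure.tendsto_iff_tendsto_charFun.2 fun t => ?_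
    -- the characteristic function at `t` is that of the real variable `⟨·, t⟩` at `1`
    let X : ℕ → Ω → ℝ := fun i ω => ∑ a, Z i ω a * t a
    have hφ : Measurable fun z : Fin k → ℝ => ∑ a, z a * t a := by fun_prop
    have hXL2 : MemLp (X 0) 2 P := memLp_finsetSum _ fun a _ => (hL2 a).mul_const (t a)
    have hX0 : P[X 0] = 0 := by
      simp only [X]
      rw [integral_finsetSum _ fun a _ => ((hL2 a).mul_const (t a)).integrable (by norm_num)]
      simp [integral_mul_const, h0]
    have hXvar : Var[X 0; P] = ∑ a, t a ^ 2 := by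
      rw [variance_of_integral_eq_zero hXL2.aestronglyMeasurable.aemeasurable hX0]
      have (ω : Ω) : X 0 ω ^ 2 = ∑ a, ∑ b, t a * t b * (Z 0 ω a * Z 0 ω b) := by
        simp only [X, sq, Finset.sum_mul_sum]
        exact Finset.sum_congr rfl fun a _ => Finset.sum_congr rfl fun b _ => by ring
      simp only [this]
      have hi (a b) : Integrable (fun ω => t a * t b * (Z 0 ω a * Z 0 ω b)) P :=
        ((hL2 a).integrable_mul (hL2 b)).const_mul _
      rw [integral_finsetSum _ fun a _ => integrable_finsetSum _ fun b _ => hi a b]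
      refine Finset.sum_congr rfl fun a _ => ?_
      rw [integral_finsetSum _ fun b _ => hi a b]
      simp [integral_const_mul, hcov, Matrix.one_apply, sq]
    have hclt := tendstoInDistribution_inv_sqrt_mul_sum_sub (X := X)
      (Y := id) (P' := gaussianReal 0 Var[X 0; P].toNNReal) HasLaw.id hXL2
      (hindep.comp (fun _ z => ∑ a, z a * t a) fun _ => hφ) (fun i => (hident i).comp hφ)
    have hchar := ProbabilityMeasure.tendsto_iff_tendsto_charFun.1 hclt.tendsto 1
    refine (hchar.congr fun n => ?_).trans_eq ?_
    · change charFun (P.map _) 1 = charFun (P.map _) t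
      have hZ (i : ℕ) : AEMeasurable (Z i) P := (hident i).aemeasurable_fst
      rw [charFun_apply, charFun_apply, integral_map (hclt.forall_aemeasurable n) (by fun_prop),
        integral_map _ (by fun_prop)]
      · refine integral_congr_ae (.of_forall fun ω => ?_)
        simp only [hX0, X, PiLp.inner_apply, RCLike.inner_apply, conj_trivial, mul_zero, sub_zero,
          one_mul]
        rw [Finset.sum_comm, Finset.mul_sum]
        congr 3
        refine Finset.sum_congr rfl fun a _ => ?_
        rw [← Finset.sum_mul]
        ring
      · refine (WithLp.measurable_toLp 2 _).comp_aemeasurable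
          (aemeasurable_pi_lambda _ fun a => ?_)
        exact (Finset.aemeasurable_fun_sum _ fun i _ =>
          (measurable_pi_apply a).comp_aemeasurable (hZ i)).const_mul _
    · change 𝓝 (charFun ((gaussianReal 0 _).map id) 1) = 𝓝 (charFun (Measure.map _ _) t)
      rw [Measure.map_id, charFun_gaussianReal, map_pi_eq_stdGaussian, charFun_stdGaussian,
        hXvar, Real.coe_toNNReal _ (Finset.sum_nonneg fun a _ => sq_nonneg _),
        ← Complex.ofReal_pow ‖t‖, EuclideanSpace.real_norm_sq_eq]
      simp [neg_div]

/-- The squared length of the normalized sum is asymptotically chi-squared. -/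
theorem tendstoInDistribution_sum_sq {k : ℕ} {Z : ℕ → Ω → Fin k → ℝ}
    (hindep : iIndepFun Z P) (hident : ∀ i, IdentDistrib (Z i) (Z 0) P P)
    (hL2 : ∀ a, MemLp (fun ω => Z 0 ω a) 2 P) (h0 : ∀ a, ∫ ω, Z 0 ω a ∂P = 0)
    (hcov : ∀ a b, ∫ ω, Z 0 ω a * Z 0 ω b ∂P = (1 : Matrix (Fin k) (Fin k) ℝ) a b) :
    TendstoInDistribution (fun (n : ℕ) (ω : Ω) =>
        ∑ a, ((√n)⁻¹ * ∑ i ∈ Finset.range n, Z i ω a) ^ 2)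
      atTop (id : ℝ → ℝ) (fun _ => P) (chiSquared k) := by
  have h := (tendstoInDistribution_normalized_sum hindep hident hL2 h0 hcov).continuous_comp
    (g := fun u : EuclideanSpace ℝ (Fin k) => ∑ a, u a ^ 2) (by fun_prop)
  refine ⟨h.forall_aemeasurable, aemeasurable_id, ?_⟩
  convert! h.tendsto using 2
  ext1
  simp only [Measure.map_id]
  rfl

end LimitTheorems

/-! ### Measurability of the objective -/

section Measurability

theorem measurable_det {X ι : Type*} [MeasurableSpace X] [Fintype ι] [DecidableEq ι]
    {M : X → Matrix ι ι ℝ} (hM : ∀ i j, Measurable fun x => M x i j) :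
    Measurable fun x => (M x).det := by
  simp only [Matrix.det_apply']
  fun_prop

theorem measurable_matrix_inv_apply {X ι : Type*} [MeasurableSpace X] [Fintype ι] [DecidableEq ι]
    {M : X → Matrix ι ι ℝ} (hM : ∀ i j, Measurable fun x => M x i j) (i j : ι) :
    Measurable fun x => (M x)⁻¹ i j := by
  simp only [Matrix.inv_def, Matrix.smul_apply, Matrix.adjugate_apply, Ring.inverse_eq_inv',
    smul_eq_mul]
  refine (measurable_det hM).inv.mul (measurable_det fun i' j' => ?_)
  by_cases h : i' = j
  · subst h
    simp
  · simpa [Matrix.updateRow_ne h] using hM i' j'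

namespace MarginalSpec

variable {p₁ p₂ q L K : ℕ} {s : MarginalSpec p₁ p₂ q L K}

theorem measurable_mu (hmean : Measurable s.mean) (j : Fin q) :
    Measurable fun z : Param p₁ p₂ × Covariate p₁ p₂ q => s.mu z.1 z.2 j := by
  refine hmean.comp ?_
  simp only [dotProduct]
  fun_prop

theorem measurable_g (hmean : Measurable s.mean) (hvar : Measurable s.varFun)
    (hgroup : ∀ k, MeasurableSet (s.group k)) (a : MomentIdx p₁ p₂ q L K) :
    Measurable fun z : Param p₁ p₂ × Obs p₁ p₂ q => s.g z.1 z.2 a := by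
  have hmu (j : Fin q) : Measurable fun z : Param p₁ p₂ × Obs p₁ p₂ q => s.mu z.1 z.2.1 j :=
    (measurable_mu hmean j).comp (measurable_fst.prodMk measurable_snd.fst)
  rcases a with a | a
  · have hdot (j : Fin q) (k : Fin p₁ ⊕ Fin p₂) :
        Measurable fun z : Param p₁ p₂ × Obs p₁ p₂ q => s.muDot z.1 z.2.1 j k := by
      have : Measurable fun z : Param p₁ p₂ × Obs p₁ p₂ q => z.2.1 j ⬝ᵥ z.1 := by
        simp only [dotProduct]
        fun_prop
      exact ((measurable_deriv s.mean).comp this).mul (by fun_prop)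
    have hA (j : Fin q) : Measurable fun z : Param p₁ p₂ × Obs p₁ p₂ q =>
        s.varA z.1 z.2.1 j ^ (-(1 / 2) : ℝ) :=
      ((hvar.comp (hmu j)).const_mul s.scale).pow_const _
    simp only [g, Sum.elim_inl, score, invSqrtA, Matrix.mulVec, dotProduct,
      Matrix.mul_apply, Matrix.transpose_apply, Pi.sub_apply]
    fun_prop
  · simp only [g, Sum.elim_inr, aux]
    refine Measurable.ite ((hgroup a.1).preimage measurable_snd.fst)
      ((hmu a.2).sub_const _) measurable_const

theorem measurable_gBar (hmean : Measurable s.mean) (hvar : Measurable s.varFun)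
    (hgroup : ∀ k, MeasurableSet (s.group k)) (n : ℕ) (a : MomentIdx p₁ p₂ q L K) :
    Measurable fun z : Param p₁ p₂ × (ℕ → Obs p₁ p₂ q) => s.gBar n z.2 z.1 a := by
  have h (i : ℕ) : Measurable fun z : Param p₁ p₂ × (ℕ → Obs p₁ p₂ q) => s.g z.1 (z.2 i) a :=
    (measurable_g hmean hvar hgroup a).comp 
      (f := fun z : Param p₁ p₂ × (ℕ → Obs p₁ p₂ q) => (z.1, z.2 i)) (by fun_prop)
  simp only [gBar]
  fun_prop

theorem measurable_sigmaBar (hmean : Measurable s.mean) (hvar : Measurable s.varFun)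
    (hgroup : ∀ k, MeasurableSet (s.group k)) (n : ℕ) (a b : MomentIdx p₁ p₂ q L K) :
    Measurable fun z : Param p₁ p₂ × (ℕ → Obs p₁ p₂ q) => s.sigmaBar n z.2 z.1 a b := by
  have h (a) (i : ℕ) : Measurable fun z : Param p₁ p₂ × (ℕ → Obs p₁ p₂ q) => s.g z.1 (z.2 i) a :=
    (measurable_g hmean hvar hgroup a).comp 
      (f := fun z : Param p₁ p₂ × (ℕ → Obs p₁ p₂ q) => (z.1, z.2 i)) (by fun_prop)
  have ha := h a
  have hb := h b
  simp only [sigmaBar, Matrix.of_apply]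
  fun_prop

theorem measurable_Q (hmean : Measurable s.mean) (hvar : Measurable s.varFun)
    (hgroup : ∀ k, MeasurableSet (s.group k)) (n : ℕ) :
    Measurable fun z : Param p₁ p₂ × (ℕ → Obs p₁ p₂ q) => s.Q n z.2 z.1 := by
  have h1 := measurable_gBar hmean hvar hgroup n
  have h2 := measurable_matrix_inv_apply (measurable_sigmaBar hmean hvar hgroup n)
  unfold Q dotProduct Matrix.mulVec dotProduct
  exact Finset.measurable_fun_sum _ fun a _ => (h1 a).mul
    (Finset.measurable_fun_sum _ fun b _ => (h2 a b).mul (h1 b))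

end MarginalSpec

end Measurability

/-! ### The sample moments -/

theorem abs_le_vecNorm {ι : Type*} [Fintype ι] (u : ι → ℝ) (i : ι) : |u i| ≤ vecNorm u := by
  rw [← Real.sqrt_sq_eq_abs]
  exact Real.sqrt_le_sqrt (Finset.single_le_sum (f := fun i => u i ^ 2)
    (fun _ _ => sq_nonneg _) (Finset.mem_univ i))

theorem norm_le_vecNorm {ι : Type*} [Fintype ι] (u : ι → ℝ) : ‖u‖ ≤ vecNorm u :=
  (pi_norm_le_iff_of_nonneg (Real.sqrt_nonneg _)).2 (abs_le_vecNorm u)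

theorem abs_le_matNorm {ι κ : Type*} [Fintype ι] [Fintype κ] (M : Matrix ι κ ℝ) (i : ι) (k : κ) :
    |M i k| ≤ matNorm M := by
  rw [← Real.sqrt_sq_eq_abs]
  refine Real.sqrt_le_sqrt ?_
  exact (Finset.single_le_sum (f := fun k => M i k ^ 2) (fun _ _ => sq_nonneg _)
    (Finset.mem_univ k)).trans (Finset.single_le_sum (f := fun i => ∑ k, M i k ^ 2)
    (fun _ _ => Finset.sum_nonneg fun _ _ => sq_nonneg _) (Finset.mem_univ i))

/-- A uniform limit in probability that is continuous at `β₀` is a joint limit at `β₀`. -/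
theorem UnifLittleOP.tendsto_prod {Ω E ι κ : Type*} [MeasurableSpace Ω] {P : Measure Ω}
    [TopologicalSpace E] [Fintype ι] [Fintype κ] {V : Set E} {β₀ : E} (hV : V ∈ 𝓝 β₀)
    {F : ℕ → Ω → E → Matrix ι κ ℝ} {G : E → Matrix ι κ ℝ} (hG : ContinuousAt G β₀)
    (h : UnifLittleOP P V fun n ω β => matNorm (F n ω β - G β)) :
    Tendsto (fun x : (ℕ × Ω) × E => F x.1.1 x.1.2 x.2) (inProb P ×ˢ 𝓝 β₀) (𝓝 (G β₀)) := by
  refine tendsto_pi_nhds.2 fun i => tendsto_pi_nhds.2 fun k => ?_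
  have h1 : Tendsto (fun x : (ℕ × Ω) × E => F x.1.1 x.1.2 x.2 i k - G x.2 i k)
      (inProb P ×ˢ 𝓝 β₀) (𝓝 0) := by
    rw [Metric.tendsto_nhds]
    intro δ hδ
    filter_upwards [(h.eventually hδ).prod_mk hV] with x hx
    rw [dist_zero_right]
    exact (abs_le_matNorm (F x.1.1 x.1.2 x.2 - G x.2) i k).trans_lt (hx.1 x.2 hx.2)
  have h2 : Tendsto (fun x : (ℕ × Ω) × E => G x.2 i k) (inProb P ×ˢ 𝓝 β₀) (𝓝 (G β₀ i k)) :=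
    (tendsto_pi_nhds.1 (tendsto_pi_nhds.1 hG.tendsto i) k).comp tendsto_snd
  simpa using h1.add h2

/-- The quadratic form `rᵀ M⁻¹ r` dominates `r_a² / M_aa`, by the Cauchy-Schwarz inequality. -/
theorem sq_le_diag_mul_invQuad {ι : Type*} [Fintype ι] [DecidableEq ι] {M : Matrix ι ι ℝ}
    (hM : M.PosDef) (r : ι → ℝ) (a : ι) : r a ^ 2 ≤ M a a * invQuad M r := by
  obtain ⟨R, hR, -⟩ := hM.exists_whitening
  have hu : IsUnit M.det := (Matrix.isUnit_iff_isUnit_det _).1 hM.isUnit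
  have hMt : M.transpose = M := by
    simpa [Matrix.IsHermitian, Matrix.conjTranspose_eq_transpose_of_trivial] using hM.isHermitian
  have h1 : r a = ∑ i, (R * M) i a * R.mulVec r i := by
    have : r = ((R * M).transpose).mulVec (R.mulVec r) := by
      rw [Matrix.mulVec_mulVec, Matrix.transpose_mul, Matrix.mul_assoc, ← hR, hMt,
        Matrix.mul_nonsing_inv _ hu, Matrix.one_mulVec]
    exact congrFun this a
  have h2 : ∑ i, (R * M) i a ^ 2 = M a a := by
    have : (R * M).transpose * (R * M) = M := by
      rw [Matrix.transpose_mul, hMt, Matrix.mul_assoc, ← Matrix.mul_assoc R.transpose, ← hR,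
        Matrix.nonsing_inv_mul _ hu, Matrix.mul_one]
    conv_rhs => rw [← this]
    rw [Matrix.mul_apply]
    simp only [Matrix.transpose_apply, sq]
  have h3 : invQuad M r = ∑ i, R.mulVec r i ^ 2 := by
    rw [invQuad, hR, ← Matrix.mulVec_mulVec, Matrix.dotProduct_mulVec, Matrix.vecMul_transpose]
    simp only [dotProduct, sq]
  rw [h1, h3, ← h2]
  exact Finset.sum_mul_sq_le_sq_mul_sq _ _ _

theorem MarginalSpec.posSemidef_sigmaBar {p₁ p₂ q L K : ℕ} (s : MarginalSpec p₁ p₂ q L K) (n : ℕ)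
    (w : ℕ → Obs p₁ p₂ q) (β : Param p₁ p₂) : (s.sigmaBar n w β).PosSemidef := by
  have : s.sigmaBar n w β =
      (n : ℝ)⁻¹ • ∑ i ∈ Finset.range n, Matrix.vecMulVec (s.g β (w i)) (star (s.g β (w i))) := by
    ext a b
    simp [MarginalSpec.sigmaBar, Matrix.sum_apply, Matrix.vecMulVec_apply]
  rw [this]
  exact (Matrix.posSemidef_sum _ fun i _ => Matrix.posSemidef_vecMulVec_self_star _).smul
    (by positivity)

/-! ### The quadratic expansion of the model -/

section Model

variable {p₁ p₂ q L K : ℕ} {Ω : Type*} [MeasurableSpace Ω] {P : Measure Ω}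
  {s : MarginalSpec p₁ p₂ q L K} {D : ℕ → Ω → Obs p₁ p₂ q}
  {Θ : Set (Param p₁ p₂)} {β₀ : Param p₁ p₂}

/-- The uniform limit of the sample moments is continuous. -/
theorem UnifLittleOP.continuousOn [IsProbabilityMeasure P] {ι : Type*} [Fintype ι]
    {F : ℕ → Ω → Param p₁ p₂ → ι → ℝ} {γ : Param p₁ p₂ → ι → ℝ}
    (hF : ∀ n, ∀ᵐ ω ∂P, ContinuousOn (F n ω) Θ)
    (h : UnifLittleOP P Θ fun n ω β => vecNorm (F n ω β - γ β)) : ContinuousOn γ Θ := by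
  refine continuousOn_of_uniform_approx_of_continuousOn fun u hu => ?_
  obtain ⟨ε, hε, hu⟩ := Metric.mem_uniformity_dist.1 hu
  obtain ⟨x, hx1, hx2⟩ := ((eventually_inProb_of_ae hF).and (h.eventually hε)).exists
  refine ⟨F x.1 x.2, hx1, fun β hβ => hu ?_⟩
  rw [dist_comm, dist_eq_norm]
  exact (norm_le_vecNorm _).trans_lt (hx2 β hβ)

theorem IsMarginalModel.measurable_g (h : IsMarginalModel P s D Θ β₀) (β : Param p₁ p₂)
    (a : MomentIdx p₁ p₂ q L K) : Measurable fun w : Obs p₁ p₂ q => s.g β w a :=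
  (MarginalSpec.measurable_g h.measurable_mean h.measurable_varFun h.measurableSet_group a).comp
    (f := fun w : Obs p₁ p₂ q => (β, w)) measurable_prodMk_left

variable [IsProbabilityMeasure P]

/-- The law of large numbers for functions of the observations. -/
theorem IsMarginalModel.tendsto_average (h : IsMarginalModel P s D Θ β₀)
    {f : Obs p₁ p₂ q → ℝ} (hf : Measurable f) (hint : Integrable (fun ω => f (D 0 ω)) P) :
    Tendsto (fun x : ℕ × Ω => (x.1 : ℝ)⁻¹ * ∑ i ∈ Finset.range x.1, f (D i x.2)) (inProb P)
      (𝓝 (∫ ω, f (D 0 ω) ∂P)) :=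
  tendsto_inProb_average (X := fun i ω => f (D i ω)) hint (h.indep.comp (fun _ => f) fun _ => hf)
    fun i => (h.identDistrib i).comp hf

omit [IsProbabilityMeasure P] in
theorem SecondMoments.memLp_g (hmodel : IsMarginalModel P s D Θ β₀)
    (h : SecondMoments P s D β₀) (a : MomentIdx p₁ p₂ q L K) :
    MemLp (fun ω => s.g β₀ (D 0 ω) a) 2 P := by
  have hmeas : Measurable fun ω => s.g β₀ (D 0 ω) a :=
    (hmodel.measurable_g β₀ a).comp (hmodel.measurable_data 0)
  rw [memLp_two_iff_integrable_sq hmeas.aestronglyMeasurable]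
  rcases a with a | a
  · simpa [MarginalSpec.g, sq] using h.integrable_score a a
  · simpa [MarginalSpec.g, sq] using h.integrable_aux a a

/-- The limit of the sample moments is the expected moment function, by the law of large
numbers. -/
theorem moment_limit_eq (hmodel : IsMarginalModel P s D Θ β₀) (hzero : UniqueZero P s D Θ β₀)
    {γ : Param p₁ p₂ → MomentIdx p₁ p₂ q L K → ℝ}
    (hγ : UnifLittleOP P Θ fun n ω β => vecNorm (s.gBar n (fun i => D i ω) β - γ β))
    {β : Param p₁ p₂} (hβ : β ∈ Θ) (a : MomentIdx p₁ p₂ q L K) :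
    γ β a = ∫ ω, s.g β (D 0 ω) a ∂P := by
  have hlln := hmodel.tendsto_average (f := fun w => s.g β w a) (hmodel.measurable_g β a)
    (hzero.integrable β hβ a)
  refine tendsto_nhds_unique (f := fun x : ℕ × Ω => s.gBar x.1 (fun i => D i x.2) β a)
    (l := inProb P) ?_ hlln
  rw [Metric.tendsto_nhds]
  intro δ hδ
  filter_upwards [hγ.eventually hδ] with x hx
  rw [Real.dist_eq]
  exact (abs_le_vecNorm (s.gBar x.1 (fun i => D i x.2) β - γ β) a).trans_lt (hx β hβ)

/-- The limiting weight at `β₀` is the second moment matrix of the moment functions. -/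
theorem weight_limit_eq (hmodel : IsMarginalModel P s D Θ β₀) (hβ₀ : β₀ ∈ Θ)
    (hmoments : SecondMoments P s D β₀)
    {S : Param p₁ p₂ → Matrix (MomentIdx p₁ p₂ q L K) (MomentIdx p₁ p₂ q L K) ℝ}
    (hS : UnifLittleOP P Θ fun n ω β => matNorm (s.sigmaBar n (fun i => D i ω) β - S β))
    (a b : MomentIdx p₁ p₂ q L K) :
    S β₀ a b = ∫ ω, s.g β₀ (D 0 ω) a * s.g β₀ (D 0 ω) b ∂P := by
  have hlln := hmodel.tendsto_average (f := fun w => s.g β₀ w a * s.g β₀ w b)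
    ((hmodel.measurable_g β₀ a).mul (hmodel.measurable_g β₀ b))
    ((hmoments.memLp_g hmodel a).integrable_mul (hmoments.memLp_g hmodel b))
  refine tendsto_nhds_unique (f := fun x : ℕ × Ω => s.sigmaBar x.1 (fun i => D i x.2) β₀ a b)
    (l := inProb P) ?_ hlln
  rw [Metric.tendsto_nhds]
  intro δ hδ
  filter_upwards [hS.eventually hδ] with x hx
  rw [Real.dist_eq]
  exact (abs_le_matNorm (s.sigmaBar x.1 (fun i => D i x.2) β₀ - S β₀) a b).trans_lt (hx β₀ hβ₀)

/-- The sample moments are bounded away from zero outside neighbourhoods of `β₀`. -/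
theorem separated_gBar (hmodel : IsMarginalModel P s D Θ β₀) (hzero : UniqueZero P s D Θ β₀)
    (hmoment : MomentRegular P s D Θ β₀) {U : Set (Param p₁ p₂)} (hU : U ∈ 𝓝 β₀) :
    ∃ c > 0, ∀ᶠ x in inProb P, ∀ β ∈ Θ \ U, c ≤ ‖s.gBar x.1 (fun i => D i x.2) β‖ := by
  obtain ⟨γ, -, hγ⟩ := hmoment.limit
  have hcont : ContinuousOn γ Θ :=
    hγ.continuousOn fun n => (hmoment.contDiffOn n).mono fun ω h => h.continuousOn
  have hcompact : IsCompact (Θ \ interior U) := hzero.isCompact.diff isOpen_interior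
  obtain ⟨c, hc, hcγ⟩ := hcompact.exists_forall_le' (f := fun β => ‖γ β‖) (a := 0)
    (hcont.mono Set.sdiff_subset).norm fun β hβ => by
      rw [norm_pos_iff]
      intro h0
      have : β = β₀ := (hzero.zero_iff β hβ.1).1 fun a => by
        rw [← moment_limit_eq hmodel hzero hγ hβ.1 a, h0, Pi.zero_apply]
      exact hβ.2 (this ▸ mem_interior_iff_mem_nhds.2 hU)
  refine ⟨c / 2, half_pos hc, ?_⟩
  filter_upwards [hγ.eventually (half_pos hc)] with x hx β hβ
  have h1 := hcγ β ⟨hβ.1, fun h => hβ.2 (interior_subset h)⟩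
  have h2 := (norm_le_vecNorm _).trans_lt (hx β hβ.1)
  have h3 := norm_sub_norm_le (γ β) (s.gBar x.1 (fun i => D i x.2) β)
  rw [norm_sub_rev] at h3
  linarith

/-- Where it is defined, the objective dominates the squared norm of the sample moments, because
the weights are bounded. -/
theorem lower_bound_objective (hzero : UniqueZero P s D Θ β₀)
    (hweight : WeightRegular P s D Θ β₀) :
    ∃ c > 0, ∀ᶠ x in inProb P, ∀ β ∈ Θ, IsUnit (s.sigmaBar x.1 (fun i => D i x.2) β).det →
      c * ‖s.gBar x.1 (fun i => D i x.2) β‖ ^ 2 ≤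
        invQuad (s.sigmaBar x.1 (fun i => D i x.2) β) (s.gBar x.1 (fun i => D i x.2) β) := by
  obtain ⟨S, -, -, hS⟩ := hweight.limit
  have hev := hS.eventually one_pos
  -- a single continuous realization of the weights bounds the limit, hence all realizations
  obtain ⟨y, hy1, hy2⟩ := ((eventually_inProb_of_ae hweight.contDiffOn).and hev).exists
  have hbound (a : MomentIdx p₁ p₂ q L K) :
      ∃ C, ∀ β ∈ Θ, ‖s.sigmaBar y.1 (fun i => D i y.2) β a a‖ ≤ C :=
    hzero.isCompact.exists_bound_of_continuousOn (hy1 a a).continuousOn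
  choose C hC using hbound
  obtain ⟨C₀, hC₀⟩ := (Set.finite_range C).bddAbove
  have hpos : 0 < |C₀| + 2 := by positivity
  refine ⟨(|C₀| + 2)⁻¹, inv_pos.2 hpos, ?_⟩
  filter_upwards [hev] with x hx β hβ hu
  have hpd : (s.sigmaBar x.1 (fun i => D i x.2) β).PosDef :=
    (s.posSemidef_sigmaBar _ _ β).posDef_iff_det_ne_zero.2 hu.ne_zero
  have hQ : 0 ≤ invQuad (s.sigmaBar x.1 (fun i => D i x.2) β) (s.gBar x.1 (fun i => D i x.2) β) :=
    hpd.inv.posSemidef.dotProduct_mulVec_nonneg _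
  have hdiag (a) : s.sigmaBar x.1 (fun i => D i x.2) β a a ≤ |C₀| + 2 := by
    have h1 := (abs_le_matNorm (s.sigmaBar x.1 (fun i => D i x.2) β - S β) a a).trans_lt (hx β hβ)
    have h2 := (abs_le_matNorm (s.sigmaBar y.1 (fun i => D i y.2) β - S β) a a).trans_lt (hy2 β hβ)
    have h3 := (le_abs_self _).trans (hC a β hβ)
    have h4 := (hC₀ (Set.mem_range_self a)).trans (le_abs_self C₀)
    rw [Matrix.sub_apply] at h1 h2
    linarith [(abs_lt.1 h1).2, (abs_lt.1 h2).1]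
  rw [inv_mul_le_iff₀ hpos]
  have hcoord : ‖s.gBar x.1 (fun i => D i x.2) β‖ ≤ √((|C₀| + 2) *
      invQuad (s.sigmaBar x.1 (fun i => D i x.2) β) (s.gBar x.1 (fun i => D i x.2) β)) := by
    refine (pi_norm_le_iff_of_nonneg (Real.sqrt_nonneg _)).2 fun a => ?_
    refine Real.abs_le_sqrt ((sq_le_diag_mul_invQuad hpd _ a).trans ?_)
    exact mul_le_mul_of_nonneg_right (hdiag a) hQ
  rwa [Real.le_sqrt (norm_nonneg _) (by positivity)] at hcoord

omit [IsProbabilityMeasure P] in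
/-- The sample moments are uniformly differentiable at `β₀`, by the mean value inequality. -/
theorem isLittleO_gBar (hΘ : Θ ∈ 𝓝 β₀)
    (hdiff : ∀ n, ∀ᵐ ω ∂P, ContDiffOn ℝ 2 (s.gBar n (fun i => D i ω)) Θ)
    {B : Matrix (MomentIdx p₁ p₂ q L K) (Fin p₁ ⊕ Fin p₂) ℝ}
    (hjac : Tendsto (fun x : (ℕ × Ω) × Param p₁ p₂ => s.jacBar x.1.1 (fun i => D i x.1.2) x.2)
      (inProb P ×ˢ 𝓝 β₀) (𝓝 B)) :
    (fun x : (ℕ × Ω) × Param p₁ p₂ => s.gBar x.1.1 (fun i => D i x.1.2) x.2 -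
      s.gBar x.1.1 (fun i => D i x.1.2) β₀ - B.mulVec (x.2 - β₀))
      =o[inProb P ×ˢ 𝓝 β₀] fun x => x.2 - β₀ := by
  rw [Asymptotics.isLittleO_iff]
  intro c hc
  let N : ℝ := Fintype.card (Fin p₁ ⊕ Fin p₂) + 1
  have hN : 0 < N := by positivity
  have hev : ∀ᶠ x : (ℕ × Ω) × Param p₁ p₂ in inProb P ×ˢ 𝓝 β₀,
      ∀ a k, |s.jacBar x.1.1 (fun i => D i x.1.2) x.2 a k - B a k| < c / N := by
    refine eventually_all.2 fun a => eventually_all.2 fun k => ?_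
    exact Metric.tendsto_nhds.1 (tendsto_pi_nhds.1 (tendsto_pi_nhds.1 hjac a) k) _ (div_pos hc hN)
  obtain ⟨pa, hpa, pb, hpb, hpab⟩ := eventually_prod_iff.1 hev
  obtain ⟨ε, hε, hball⟩ := Metric.nhds_basis_ball.mem_iff.1 (inter_mem hΘ hpb)
  refine eventually_prod_iff.2 ⟨_, hpa.and (eventually_inProb_of_ae hdiff), _,
    Metric.ball_mem_nhds β₀ hε, ?_⟩
  rintro x ⟨hx, hxd⟩ β hβ
  refine (pi_norm_le_iff_of_nonneg (by positivity)).2 fun a => ?_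
  let f : Param p₁ p₂ → ℝ := fun b => s.gBar x.1 (fun i => D i x.2) b a
  let ℓ : Param p₁ p₂ →L[ℝ] ℝ :=
    (LinearMap.proj a ∘ₗ B.mulVecLin : Param p₁ p₂ →ₗ[ℝ] ℝ).toContinuousLinearMap
  have hℓ (v) : ℓ v = B.mulVec v a := rfl
  have hderiv : ∀ b ∈ Metric.ball β₀ ε,
      HasFDerivWithinAt (fun b => f b - ℓ b) (fderiv ℝ f b - ℓ) (Metric.ball β₀ ε) b := by
    intro b hb
    have h1 : DifferentiableAt ℝ (s.gBar x.1 (fun i => D i x.2)) b :=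
      (hxd.contDiffAt (mem_of_superset (Metric.isOpen_ball.mem_nhds hb)
        fun z hz => (hball hz).1)).differentiableAt (by norm_num)
    have h2 : DifferentiableAt ℝ f b := differentiableAt_pi.1 h1 a
    exact (h2.hasFDerivAt.sub ℓ.hasFDerivAt).hasFDerivWithinAt
  have hnorm : ∀ b ∈ Metric.ball β₀ ε, ‖fderiv ℝ f b - ℓ‖ ≤ c := by
    intro b hb
    refine ContinuousLinearMap.opNorm_le_bound _ hc.le fun v => ?_
    have hv : (fderiv ℝ f b - ℓ) v =
        ∑ k, v k * (s.jacBar x.1 (fun i => D i x.2) b a k - B a k) := by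
      have : v = ∑ k, v k • (Pi.single k 1 : Param p₁ p₂) := by
        ext j
        simp [Finset.sum_apply, Pi.single_apply]
      conv_lhs => rw [this]
      simp only [map_sum, map_smul, smul_eq_mul]
      refine Finset.sum_congr rfl fun k _ => ?_
      rw [sub_apply, hℓ, Matrix.mulVec_single_one]
      rfl
    rw [hv]
    calc ‖∑ k, v k * (s.jacBar x.1 (fun i => D i x.2) b a k - B a k)‖
        ≤ ∑ k : Fin p₁ ⊕ Fin p₂, ‖v‖ * (c / N) := by
          refine norm_sum_le_of_le _ fun k _ => ?_
          rw [norm_mul]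
          exact mul_le_mul (norm_le_pi_norm v k) (hpab hx (hball hb).2 a k).le (norm_nonneg _)
            (norm_nonneg _)
      _ = (N - 1) * (‖v‖ * (c / N)) := by simp [N]
      _ ≤ N * (‖v‖ * (c / N)) := by gcongr; linarith
      _ = c * ‖v‖ := by field_simp
  have := (convex_ball β₀ ε).norm_image_sub_le_of_norm_hasFDerivWithin_le hderiv hnorm
    (Metric.mem_ball_self hε) hβ
  refine le_of_eq_of_le ?_ this
  simp only [Pi.sub_apply, f, hℓ, Matrix.mulVec_sub]
  congr 1
  ring

theorem hasQuadraticExpansion_gBar (hmodel : IsMarginalModel P s D Θ β₀)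
    (hzero : UniqueZero P s D Θ β₀) (hweight : WeightRegular P s D Θ β₀)
    (hmoment : MomentRegular P s D Θ β₀)
    {S : Param p₁ p₂ → Matrix (MomentIdx p₁ p₂ q L K) (MomentIdx p₁ p₂ q L K) ℝ}
    (hScont : ContinuousAt S β₀) (hSpos : (S β₀).PosDef)
    (hS : UnifLittleOP P Θ fun n ω β => matNorm (s.sigmaBar n (fun i => D i ω) β - S β))
    {G : Param p₁ p₂ → Matrix (MomentIdx p₁ p₂ q L K) (Fin p₁ ⊕ Fin p₂) ℝ}
    (hGcont : ContinuousAt G β₀) (hGinj : Function.Injective (G β₀).mulVec)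
    {V : Set (Param p₁ p₂)} (hV : V ∈ 𝓝 β₀)
    (hG : UnifLittleOP P V fun n ω β => matNorm (s.jacBar n (fun i => D i ω) β - G β)) :
    HasQuadraticExpansion (inProb P) (fun x β => s.gBar x.1 (fun i => D i x.2) β)
      (fun x β => s.sigmaBar x.1 (fun i => D i x.2) β) Θ β₀ (G β₀) (S β₀) where
  mem_nhds := mem_interior_iff_mem_nhds.1 hzero.mem_interior
  isUnit := (Matrix.isUnit_iff_isUnit_det _).1 hSpos.isUnit
  injective := hGinj
  continuousOn_moment :=
    (eventually_inProb_of_ae hmoment.contDiffOn).mono fun _ h => h.continuousOn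
  continuousOn_weight := (eventually_inProb_of_ae hweight.contDiffOn).mono fun _ h =>
    continuousOn_pi.2 fun a => continuousOn_pi.2 fun b => (h a b).continuousOn
  weight := hS.tendsto_prod (mem_interior_iff_mem_nhds.1 hzero.mem_interior) hScont
  expansion := isLittleO_gBar (mem_interior_iff_mem_nhds.1 hzero.mem_interior)
    hmoment.contDiffOn (hG.tendsto_prod hV hGcont)
  lower := lower_bound_objective hzero hweight
  separated _ hU := separated_gBar hmodel hzero hmoment hU

end Model

/-! ### The limiting distribution -/

section Limit

variable {p₁ p₂ q L K : ℕ} {Ω : Type*} [MeasurableSpace Ω] {P : Measure Ω}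
  [IsProbabilityMeasure P] {s : MarginalSpec p₁ p₂ q L K} {D : ℕ → Ω → Obs p₁ p₂ q}
  {Θ : Set (Param p₁ p₂)} {β₀ : Param p₁ p₂}

theorem tight_sqrt_smul_gBar (hmodel : IsMarginalModel P s D Θ β₀)
    (hmoments : SecondMoments P s D β₀) (h0 : ∀ a, ∫ ω, s.g β₀ (D 0 ω) a ∂P = 0)
    (ε : ENNReal) (hε : 0 < ε) :
    ∃ R : ℝ, ∀ n : ℕ, P {ω | R < ‖√n • s.gBar n (fun i => D i ω) β₀‖} ≤ ε := by
  let c : ENNReal := Fintype.card (MomentIdx p₁ p₂ q L K)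
  have hpos : 0 < ε / c := ENNReal.div_pos hε.ne' (ENNReal.natCast_ne_top _)
  have hcoord (a : MomentIdx p₁ p₂ q L K) := tight_normalized_sum
    (X := fun i ω => s.g β₀ (D i ω) a) (hmoments.memLp_g hmodel a) (h0 a)
    (hmodel.indep.comp (fun _ w => s.g β₀ w a) fun _ => hmodel.measurable_g β₀ a)
    (fun i => (hmodel.identDistrib i).comp (hmodel.measurable_g β₀ a)) _ hpos
  choose R hR using hcoord
  obtain ⟨R₀, hR₀⟩ := (Set.finite_range R).bddAbove
  refine ⟨|R₀|, fun n => ?_⟩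
  calc P {ω | |R₀| < ‖√n • s.gBar n (fun i => D i ω) β₀‖}
      ≤ P (⋃ a, {ω | R a < |√n * ((n : ℝ)⁻¹ * ∑ i ∈ Finset.range n, s.g β₀ (D i ω) a)|}) := by
        refine measure_mono fun ω (hω : |R₀| < _) => ?_
        by_contra hn
        refine hω.not_ge ((pi_norm_le_iff_of_nonneg (abs_nonneg _)).2 fun a => ?_)
        rw [Set.mem_iUnion, not_exists] at hn
        have hRa := (hR₀ (Set.mem_range_self a)).trans (le_abs_self R₀)
        exact (not_lt.1 (hn a)).trans hRa
    _ ≤ ∑ a, P {ω | R a < |√n * ((n : ℝ)⁻¹ * ∑ i ∈ Finset.range n, s.g β₀ (D i ω) a)|} :=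
        measure_iUnion_fintype_le _ _
    _ ≤ ∑ _a : MomentIdx p₁ p₂ q L K, ε / c := Finset.sum_le_sum fun a _ => hR a n
    _ = c * (ε / c) := by simp [c]
    _ ≤ ε := ENNReal.mul_div_le

/-- A linear map that whitens the moment functions sends the normalized sample moments to a vector
whose squared length is asymptotically chi-squared. -/
theorem tendstoInDistribution_whitened (hmodel : IsMarginalModel P s D Θ β₀)
    (hmoments : SecondMoments P s D β₀) (h0 : ∀ a, ∫ ω, s.g β₀ (D 0 ω) a ∂P = 0)
    {S₀ : Matrix (MomentIdx p₁ p₂ q L K) (MomentIdx p₁ p₂ q L K) ℝ}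
    (hS₀ : ∀ a b, S₀ a b = ∫ ω, s.g β₀ (D 0 ω) a * s.g β₀ (D 0 ω) b ∂P)
    {k : ℕ} {A : Matrix (Fin k) (MomentIdx p₁ p₂ q L K) ℝ} (hA : A * S₀ * A.transpose = 1) :
    TendstoInDistribution (fun (n : ℕ) (ω : Ω) =>
        ∑ i, A.mulVec (√n • s.gBar n (fun i => D i ω) β₀) i ^ 2)
      atTop (id : ℝ → ℝ) (fun _ => P) (chiSquared k) := by
  let φ : Obs p₁ p₂ q → Fin k → ℝ := fun w => A.mulVec (s.g β₀ w)
  have hg := hmodel.measurable_g β₀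
  have hφ : Measurable φ := by
    refine measurable_pi_lambda _ fun i => ?_
    exact Finset.measurable_fun_sum _ fun a _ => (hg a).const_mul (A i a)
  have hL2 (a) := hmoments.memLp_g hmodel a
  have hφ_apply (w i) : φ w i = ∑ a, A i a * s.g β₀ w a := rfl
  have hmean (i) : ∫ ω, φ (D 0 ω) i ∂P = 0 := by
    simp only [hφ_apply]
    rw [integral_finsetSum _ fun a _ => ((hL2 a).integrable (by norm_num)).const_mul _]
    simp [integral_const_mul, h0]
  have hcov (i j) : ∫ ω, φ (D 0 ω) i * φ (D 0 ω) j ∂P = (1 : Matrix (Fin k) (Fin k) ℝ) i j := by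
    have hint (a b) : Integrable
        (fun ω => A i a * A j b * (s.g β₀ (D 0 ω) a * s.g β₀ (D 0 ω) b)) P :=
      ((hL2 a).integrable_mul (hL2 b)).const_mul _
    have hprod (ω : Ω) : φ (D 0 ω) i * φ (D 0 ω) j =
        ∑ a, ∑ b, A i a * A j b * (s.g β₀ (D 0 ω) a * s.g β₀ (D 0 ω) b) := by
      rw [hφ_apply, hφ_apply, Finset.sum_mul_sum]
      exact Finset.sum_congr rfl fun a _ => Finset.sum_congr rfl fun b _ => by ring
    simp only [hprod]
    rw [integral_finsetSum _ fun a _ => integrable_finsetSum _ fun b _ => hint a b, ← hA,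
      Matrix.mul_assoc, Matrix.mul_apply]
    refine Finset.sum_congr rfl fun a _ => ?_
    rw [integral_finsetSum _ fun b _ => hint a b, Matrix.mul_apply, Finset.mul_sum]
    refine Finset.sum_congr rfl fun b _ => ?_
    rw [integral_const_mul, ← hS₀, Matrix.transpose_apply]
    ring
  have hclt := tendstoInDistribution_sum_sq (Z := fun i ω => φ (D i ω))
    (hmodel.indep.comp (fun _ => φ) fun _ => hφ) (fun i => (hmodel.identDistrib i).comp hφ)
    (fun i => memLp_finsetSum _ fun a _ => (hL2 a).const_mul (A i a)) hmean hcov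
  -- also true for `n = 0`, where both sides vanish
  have hsqrt (n : ℕ) : √(n : ℝ) * (n : ℝ)⁻¹ = (√n)⁻¹ := by
    rw [← div_eq_mul_inv, Real.sqrt_div_self]
  refine hclt.congr (fun n => .of_forall fun ω => ?_) .rfl
  refine Finset.sum_congr rfl fun i _ => ?_
  congr 1
  simp only [hφ_apply, Matrix.mulVec, dotProduct, Pi.smul_apply, smul_eq_mul, MarginalSpec.gBar]
  rw [Finset.sum_comm, Finset.mul_sum]
  refine Finset.sum_congr rfl fun a _ => ?_
  rw [← Finset.mul_sum, ← hsqrt]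
  ring

end Limit

theorem theorem2 {p₁ p₂ q L K : ℕ} {Ω : Type*} [MeasurableSpace Ω]
    (P : Measure Ω) [IsProbabilityMeasure P]
    (s : MarginalSpec p₁ p₂ q L K) (D : ℕ → Ω → Obs p₁ p₂ q)
    (Θ : Set (Param p₁ p₂)) (γ₀ : Fin p₁ → ℝ) (lam₀ : Fin p₂ → ℝ)
    (hmodel : IsMarginalModel P s D Θ (Sum.elim γ₀ lam₀))
    (hzero : UniqueZero P s D Θ (Sum.elim γ₀ lam₀))
    (hmoments : SecondMoments P s D (Sum.elim γ₀ lam₀))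
    (hvariance : VarianceRegular P s D Θ)
    (hweight : WeightRegular P s D Θ (Sum.elim γ₀ lam₀))
    (hmoment : MomentRegular P s D Θ (Sum.elim γ₀ lam₀))
    -- the unconstrained estimator: a minimizer of `Q_n` over `Θ`, whenever there is one
    (βhat : ℕ → Ω → Param p₁ p₂) (hβhat_meas : ∀ n, AEMeasurable (βhat n) P)
    (hβhat : ∀ n, ∀ᵐ ω ∂P, (∃ b, s.IsGMM Θ n (fun i => D i ω) b) →
      s.IsGMM Θ n (fun i => D i ω) (βhat n ω))
    -- the constrained estimator: a minimizer of `Q_n(γ₀, ·)`, whenever there is one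
    (lamtilde : ℕ → Ω → Fin p₂ → ℝ) (hlamtilde_meas : ∀ n, AEMeasurable (lamtilde n) P)
    (hlamtilde : ∀ n, ∀ᵐ ω ∂P,
      (∃ b, s.IsGMM {β ∈ Θ | ∀ i, β (Sum.inl i) = γ₀ i} n (fun i => D i ω) b) →
      s.IsGMM {β ∈ Θ | ∀ i, β (Sum.inl i) = γ₀ i} n (fun i => D i ω)
        (Sum.elim γ₀ (lamtilde n ω))) :
    TendstoInDistribution
      (fun (n : ℕ) (ω : Ω) =>
        (n : ℝ) * (s.Q n (fun i => D i ω) (Sum.elim γ₀ (lamtilde n ω)) -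
          s.Q n (fun i => D i ω) (βhat n ω)))
      atTop (id : ℝ → ℝ) (fun _ => P) (chiSquared p₁) := by
  obtain ⟨S, hScont, hSpos, hS⟩ := hweight.limit
  obtain ⟨G, hGcont, hGinj, V, hV, hG⟩ := hmoment.jacobian
  have hexp := hasQuadraticExpansion_gBar hmodel hzero hweight hmoment hScont hSpos hS hGcont hGinj
    hV hG
  have hΘ : Sum.elim γ₀ lam₀ ∈ Θ := interior_subset hzero.mem_interior
  have h0 := (hzero.zero_iff _ hΘ).2 rfl
  -- the directions along which the constrained parameter moves
  let T : Submodule ℝ (Param p₁ p₂) := LinearMap.ker (LinearMap.funLeft ℝ ℝ Sum.inl)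
  have hT (t : Param p₁ p₂) : t ∈ T ↔ ∀ i, t (Sum.inl i) = 0 := by
    rw [LinearMap.mem_ker, funext_iff]
    rfl
  obtain ⟨A, τ, τ', hA, hτmin, hτT, hτmin', hdiff⟩ := exists_least_squares_difference hSpos hGinj hT
  have hfull : Θ ∩ {β | β - Sum.elim γ₀ lam₀ ∈ (⊤ : Submodule ℝ (Param p₁ p₂))} = Θ := by simp
  have hconstr : Θ ∩ {β | β - Sum.elim γ₀ lam₀ ∈ T} = {β ∈ Θ | ∀ i, β (Sum.inl i) = γ₀ i} := by
    ext β
    simp only [Set.mem_inter_iff, Set.mem_ofPred_eq, hT, Pi.sub_apply, Sum.elim_inl, sub_eq_zero]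
  refine tendstoInDistribution_of_tendstoInMeasure_sub _ _
    (tendstoInDistribution_whitened hmodel hmoments h0
      (weight_limit_eq hmodel hΘ hmoments hS) hA) ?_ fun n => ?_
  · refine tendstoInMeasure_of_tendsto_inProb (X := fun n ω => _) (c := 0) ?_
    refine tendsto_inProb_of_truncated
      (W := fun x => √x.1 • s.gBar x.1 (fun i => D i x.2) (Sum.elim γ₀ lam₀))
      (tight_sqrt_smul_gBar hmodel hmoments h0) fun R => ?_
    have hexp' := hexp.mono (inf_le_left (b := 𝓟 {x : ℕ × Ω |
      ‖√x.1 • s.gBar x.1 (fun i => D i x.2) (Sum.elim γ₀ lam₀)‖ ≤ R}))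
    have hN : Tendsto (fun x : ℕ × Ω => √(x.1 : ℝ)) (inProb P ⊓ 𝓟 {x : ℕ × Ω |
        ‖√x.1 • s.gBar x.1 (fun i => D i x.2) (Sum.elim γ₀ lam₀)‖ ≤ R}) atTop :=
      (Real.tendsto_sqrt_atTop.comp (tendsto_natCast_atTop_atTop.comp tendsto_fst_inProb)).mono_left
        inf_le_left
    have hw : (fun x : ℕ × Ω => √x.1 • s.gBar x.1 (fun i => D i x.2) (Sum.elim γ₀ lam₀))
        =O[inProb P ⊓ 𝓟 {x : ℕ × Ω |
        ‖√x.1 • s.gBar x.1 (fun i => D i x.2) (Sum.elim γ₀ lam₀)‖ ≤ R}] fun _ => (1 : ℝ) := by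
      refine .of_bound R ?_
      filter_upwards [mem_inf_of_right (mem_principal_self _)] with x hx
      simpa using hx
    have h1 := hexp'.tendsto_min (b := fun x => βhat x.1 x.2) hN hw ⊤ (τ := τ)
      (fun _ => trivial) (fun w t _ => hτmin w t) (by
        rw [hfull]
        exact (eventually_inProb_of_ae hβhat).filter_mono inf_le_left)
    have h2 := hexp'.tendsto_min (b := fun x => Sum.elim γ₀ (lamtilde x.1 x.2)) hN hw T (τ := τ')
      hτT hτmin' (by
        rw [hconstr]
        exact (eventually_inProb_of_ae hlamtilde).filter_mono inf_le_left)
    have h3 := h2.sub h1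
    rw [sub_zero] at h3
    refine h3.congr fun x => ?_
    have h4 := hdiff (√x.1 • s.gBar x.1 (fun i => D i x.2) (Sum.elim γ₀ lam₀))
    simp only [Pi.sub_apply, ← h4, Real.sq_sqrt (Nat.cast_nonneg x.1)]
    simp only [MarginalSpec.Q, invQuad]
    ring
  · have hQ := MarginalSpec.measurable_Q (s := s) hmodel.measurable_mean hmodel.measurable_varFun
      hmodel.measurableSet_group n
    have hdata : Measurable fun ω i => D i ω := measurable_pi_lambda _ hmodel.measurable_data
    have htilde : AEMeasurable (fun ω => (Sum.elim γ₀ (lamtilde n ω) : Param p₁ p₂)) P := by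
      refine aemeasurable_pi_lambda _ fun i => ?_
      rcases i with i | i
      · exact aemeasurable_const
      · exact (measurable_pi_apply i).comp_aemeasurable (hlamtilde_meas n)
    exact ((hQ.comp_aemeasurable (htilde.prodMk hdata.aemeasurable)).sub
      (hQ.comp_aemeasurable ((hβhat_meas n).prodMk hdata.aemeasurable))).const_mul _
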